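/- Let $n\ge 1$ and let $\mathcal D$ be the collection of all open dyadic cubes $\prod_{i=1}^n\big(k_i2^{-m},(k_i+1)2^{-m}\big)$, $m\in\mathbb Z$, $k\in\mathbb Z^n$, in $\mathbb R^n$. For $J\in\mathcal D$ write $\langle\varphi\rangle_J=\frac1{|J|}\int_J\varphi$. For $\varepsilon\ge0$ let $\mathrm{BMO}^d_\varepsilon(\mathbb R^n)$ be the set of locally integrable $\varphi$ on $\mathbb R^n$ with $$\sup_{J\in\mathcal D}\big\langle|\varphi-\langle\varphi\rangle_J|^2\big\rangle_J^{1/2}\le\varepsilon,$$ and, for $Q\in\mathcal D$, let $\mathrm{BMO}^d_\varepsilon(Q)$ be the set of integrable $\varphi$ on $Q$ for which the same bound holds with the supremum over the cubes $J\in\mathcal D$, $J\subseteq Q$. Let $\varepsilon_0^d(n)$ be the sharp constant in the integral John–Nirenberg inequality, i.e. the largest $e\in[0,\infty]$ such that for every $0\le\varepsilon<e$ there is $C>0$ with $\langle e^\varphi\rangle_Q\le C\,e^{\langle\varphi\rangle_Q}$ for all $\varphi\in\mathrm{BMO}^d_\varepsilon(\mathbb R^n)$ and all $Q\in\mathcal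 D$. For $\varepsilon>0$ let $\Omega_\varepsilon=\{(x_1,x_2)\in\mathbb R^2: x_1^2\le x_2\le x_1^2+\varepsilon^2\}$ and $\Gamma_0=\{(x_1,x_2): x_2=x_1^2\}$. For $Q\in\mathcal D$ and $x\in\Omega_\varepsilon$ let $$\mathbf B^n_\varepsilon(x)=\sup\big\{\langle e^\varphi\rangle_Q:\ \varphi\in\mathrm{BMO}^d_\varepsilon(Q),\ \langle\varphi\rangle_Q=x_1,\ \langle\varphi^2\rangle_Q=x_2\big\}\in[0,\infty].$$ For $\alpha\in(0,\frac12]$ let $\delta(\alpha,\varepsilon)$ denote the solution $\delta$ of $$\frac{1-\sqrt{\delta^2-\varepsilon^2}}{1-\delta}\,e^{-\delta+\sqrt{\delta^2-\varepsilon^2}}=\frac{1-\alpha}{e^{\sqrt\alpha\,\varepsilon}-\alpha e^{\varepsilon/\sqrt\alpha}},\qquad \varepsilon<\delta<\min\Big\{1,\frac{1+\alpha}{2\sqrt\alpha}\,\varepsilon\Big\},$$ and let $$B_{\alpha,\varepsilon}(x)=\frac{e^{-\delta}}{1-\delta}\,e^{x_1+r(x)}\,(1-r(x)),\qquad r(x)=\sqrt{\delta^2-x_2+x_1^2},\qquad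 \delta=\delta(\alpha,\varepsilon).$$ **Theorem.** Let $n\ge1$, $Q\in\mathcal D$ and $\varepsilon>0$. 1. If $\varepsilon<\varepsilon_0^d(n)$, then $\delta(2^{-n},\varepsilon)$ exists and is unique, and $\mathbf B^n_\varepsilon(x)=B_{2^{-n},\varepsilon}(x)$ for all $x\in\Omega_\varepsilon$. 2. If $\varepsilon\ge\varepsilon_0^d(n)$, then $\mathbf B^n_\varepsilon(x)=e^{x_1}$ for $x\in\Gamma_0$, and $\mathbf B^n_\varepsilon(x)=+\infty$ for $x\in\Omega_\varepsilon\setminus\Gamma_0$. -/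

import Mathlib

open MeasureTheory Set
open scoped ENNReal

noncomputable section

namespace DyadicBMO

/-- The open dyadic cube `∏ᵢ (kᵢ 2⁻ᵐ, (kᵢ + 1) 2⁻ᵐ)` of side length `2⁻ᵐ` in `ℝⁿ`. -/
def cube (n : ℕ) (m : ℤ) (k : Fin n → ℤ) : Set (Fin n → ℝ) :=
  Set.univ.pi fun i => Set.Ioo ((k i : ℝ) * (2 : ℝ) ^ (-m)) (((k i : ℝ) + 1) * (2 : ℝ) ^ (-m))

/-- The collection of all open dyadic cubes in `ℝⁿ`, with root cube `(0,1)ⁿ`. -/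
def dyadicCubes (n : ℕ) : Set (Set (Fin n → ℝ)) :=
  {J | ∃ (m : ℤ) (k : Fin n → ℤ), J = cube n m k}

/-- The collection of all dyadic subcubes of `Q` (including `Q`, when `Q` is dyadic). -/
def dyadicSubcubes (n : ℕ) (Q : Set (Fin n → ℝ)) : Set (Set (Fin n → ℝ)) :=
  {J | J ∈ dyadicCubes n ∧ J ⊆ Q}

/-- The `2`-oscillation of `φ` over `J`, the average over `J` of `|φ - ⟨φ⟩_J|²`,
as an extended nonnegative real. -/
def oscillation {n : ℕ} (J : Set (Fin n → ℝ)) (φ : (Fin n → ℝ) → ℝ) : ℝ≥0∞ :=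
  ⨍⁻ t in J, ENNReal.ofReal (|φ t - ⨍ s in J, φ s| ^ 2) ∂volume

/-- The `BMO` norm with respect to a collection `S` of sets: the supremum over `J ∈ S` of the
square root of the `2`-oscillation. -/
def bmoNorm {n : ℕ} (S : Set (Set (Fin n → ℝ))) (φ : (Fin n → ℝ) → ℝ) : ℝ≥0∞ :=
  ⨆ J ∈ S, oscillation J φ ^ (1 / 2 : ℝ)

/-- Locally integrable functions on `ℝⁿ` whose dyadic `BMO` norm does not exceed `ε`. -/
def bmoBall (n : ℕ) (ε : ℝ) : Set ((Fin n → ℝ) → ℝ) :=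
  {φ | LocallyIntegrable φ volume ∧ bmoNorm (dyadicCubes n) φ ≤ ENNReal.ofReal ε}

/-- Integrable functions on the cube `Q` whose dyadic `BMO` norm on `Q` does not exceed `ε`
(only the values on `Q` matter). -/
def bmoBallOn (n : ℕ) (Q : Set (Fin n → ℝ)) (ε : ℝ) : Set ((Fin n → ℝ) → ℝ) :=
  {φ | IntegrableOn φ Q volume ∧ bmoNorm (dyadicSubcubes n Q) φ ≤ ENNReal.ofReal ε}

/-- The average `⟨e^φ⟩_Q`, possibly infinite. -/
def expAverage {n : ℕ} (Q : Set (Fin n → ℝ)) (φ : (Fin n → ℝ) → ℝ) : ℝ≥0∞ :=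
  ⨍⁻ t in Q, ENNReal.ofReal (Real.exp (φ t)) ∂volume

/-- The integral John--Nirenberg inequality holds for dyadic `BMO` functions on `ℝⁿ` of norm at
most `ε`, with some constant `C`. -/
def JohnNirenbergHolds (n : ℕ) (ε : ℝ) : Prop :=
  ∃ C : ℝ, 0 < C ∧ ∀ φ ∈ bmoBall n ε, ∀ Q ∈ dyadicCubes n,
    expAverage Q φ ≤ ENNReal.ofReal (C * Real.exp (⨍ t in Q, φ t))

/-- The sharp constant `ε₀ᵈ(n)`: the largest `e` such that the integral John--Nirenberg inequality
holds for every `0 ≤ ε < e`. -/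
def sharpEps (n : ℕ) : ℝ≥0∞ :=
  sSup {e | ∀ ε : ℝ, 0 ≤ ε → ENNReal.ofReal ε < e → JohnNirenbergHolds n ε}

/-- The parabolic strip `Ω_ε`. -/
def strip (ε : ℝ) : Set (ℝ × ℝ) :=
  {x | x.1 ^ 2 ≤ x.2 ∧ x.2 ≤ x.1 ^ 2 + ε ^ 2}

/-- The parabola `Γ_ξ`; `Γ_0` is the lower boundary of the strip. -/
def parabola (ξ : ℝ) : Set (ℝ × ℝ) :=
  {x | x.2 = x.1 ^ 2 + ξ ^ 2}

/-- The Bellman function of the integral John--Nirenberg inequality on the cube `Q`. -/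
def bellman (n : ℕ) (Q : Set (Fin n → ℝ)) (ε : ℝ) (x : ℝ × ℝ) : ℝ≥0∞ :=
  sSup {y | ∃ φ ∈ bmoBallOn n Q ε,
    (⨍ t in Q, φ t) = x.1 ∧ (⨍ t in Q, φ t ^ 2) = x.2 ∧ y = expAverage Q φ}

/-- The constant `K(α, ε)`. -/
def K (α ε : ℝ) : ℝ :=
  (1 - α) / (Real.exp (√α * ε) - α * Real.exp (ε / √α))

/-- The function `g(α, δ, ε)`. -/
def g (α δ ε : ℝ) : ℝ :=
  (1 - √(δ ^ 2 - ε ^ 2)) / (1 - δ) * Real.exp (-δ + √(δ ^ 2 - ε ^ 2)) - K α ε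

/-- The conditions that determine `δ(α, ε)`. -/
def IsDelta (α ε δ : ℝ) : Prop :=
  g α δ ε = 0 ∧ ε < δ ∧ δ < min 1 ((1 + α) / (2 * √α) * ε)

/-- The number `δ(α, ε)`: the solution of `IsDelta α ε`, when there is one. -/
def delta (α ε : ℝ) : ℝ :=
  Classical.epsilon (IsDelta α ε)

/-- The function `B_δ(x) = e^{-δ} / (1 - δ) * e^{x₁ + r(x)} (1 - r(x))` with
`r(x) = √(δ² - x₂ + x₁²)`. -/
def Bfun (δ : ℝ) (x : ℝ × ℝ) : ℝ :=
  Real.exp (-δ) / (1 - δ) * Real.exp (x.1 + √(δ ^ 2 - x.2 + x.1 ^ 2)) *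
    (1 - √(δ ^ 2 - x.2 + x.1 ^ 2))

/-- The function `B_{α,ε} = B_{δ(α,ε)}`. -/
def Bcand (α ε : ℝ) (x : ℝ × ℝ) : ℝ :=
  Bfun (delta α ε) x

end DyadicBMO

end

/-!
With `α = 2⁻ⁿ`, `h(t) = (1 - t) eᵗ` (`profile`) and the variance `V = x₂ - x₁²` (`var`), the
candidate is `e^{x₁} h(√(δ² - V)) / h(δ)`. It is affine along the tangents to the parabola
`V = δ²`, which lies above the strip.

**Upper bound.** Everything rests on one inequality (`chord_le`): the candidate is concave across
every splitting of a point of the strip into two points of the strip with weights in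
`[α, 1 - α]`, although the chord may leave the strip. Concavity on short chords is the concavity of
`h` as a function of `-t²` (`chord_of_le`). A long chord is shortened while the variances
of its middle point and of its left endpoint are kept, then reduced to one whose right endpoint
and whose middle point lie on the upper boundary; there the defect of the inequality, as a function
of the length of the chord, first increases and then decreases (`boundary_chord`), so the extreme case is the splitting of an upper boundary point
into an upper boundary point and a lower boundary point. For the weight `α` this is an equality,
by the equation that defines `δ`, and for larger weights it follows from `kappa_mono`.
A point which is the mean of `2ⁿ` points of the strip can be split by removing one of them at a time
(`CandidateData.sum_le`). So the mean of the candidate over the dyadic descendants of a cube does not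
increase with the generation; since `e^{x₁}` is at most the candidate, the Lebesgue
differentiation theorem and Fatou's lemma bound `⟨e^φ⟩_Q` (`CandidateData.expAverage_le`).

**Lower bound.** Gluing test functions on the children of a cube keeps the `BMO` bound as soon as
the variance over the cube itself is admissible (`attained_glue`). A test function that is constant
on all children but one, where it repeats itself up to an additive constant, is extremal on the upper
boundary; its finite approximations have exponential averages `topValue`, which obey an affine
recursion. They converge to `K α ε` when `α e^{ε/√α} < e^{√α ε}` (`Subcritical`) and tend to infinity
otherwise. The points inside the strip are reached by mixing these functions with constants along
the extremal tangents.

**The sharp constant.** The two bounds identify the condition `ε < ε₀ᵈ(n)` with `Subcritical`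
(`lt_sharpEps_iff`).
-/

noncomputable section

namespace DyadicBMO

/-! ### One-variable inequalities -/

lemma le_of_hasDerivAt_nonneg {f f' : ℝ → ℝ} {a b : ℝ} (hab : a ≤ b)
    (hd : ∀ x ∈ Icc a b, HasDerivAt f (f' x) x) (hn : ∀ x ∈ Icc a b, 0 ≤ f' x) : f a ≤ f b := by
  have hm : MonotoneOn f (Icc a b) := by
    apply monotoneOn_of_hasDerivWithinAt_nonneg (f' := f') (convex_Icc a b)
    · exact fun x hx => (hd x hx).continuousAt.continuousWithinAt
    · exact fun x hx => (hd x (interior_subset hx)).hasDerivWithinAt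
    · exact fun x hx => hn x (interior_subset hx)
  exact hm (left_mem_Icc.2 hab) (right_mem_Icc.2 hab) hab

lemma lt_of_hasDerivAt_pos {f f' : ℝ → ℝ} {a b : ℝ} (hab : a < b)
    (hd : ∀ x ∈ Icc a b, HasDerivAt f (f' x) x) (hn : ∀ x ∈ Ioo a b, 0 < f' x) : f a < f b := by
  have hm : StrictMonoOn f (Icc a b) := by
    apply strictMonoOn_of_deriv_pos (convex_Icc a b)
    · exact fun x hx => (hd x hx).continuousAt.continuousWithinAt
    · intro x hx
      rw [(hd x (interior_subset hx)).deriv]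
      rw [interior_Icc] at hx
      exact hn x hx
  exact hm (left_mem_Icc.2 hab.le) (right_mem_Icc.2 hab.le) hab

/-- The profile of the Bellman candidate: along the strip it is
`e^{x₁} · profile (√(δ² - x₂ + x₁²))`, up to a constant factor. -/
def profile (t : ℝ) : ℝ := (1 - t) * Real.exp t

lemma hasDerivAt_profile (t : ℝ) : HasDerivAt profile (-(t * Real.exp t)) t := by
  have := ((hasDerivAt_const t (1:ℝ)).sub (hasDerivAt_id t)).mul (Real.hasDerivAt_exp t)
  refine this.congr_deriv ?_
  simp; ring

lemma profile_anti {s t : ℝ} (hs : 0 ≤ s) (hst : s ≤ t) : profile t ≤ profile s := by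
  have := le_of_hasDerivAt_nonneg (f := fun x => - profile x) hst
    (fun x _ => (hasDerivAt_profile x).neg)
    (fun x hx => by
      have : 0 ≤ x := hs.trans hx.1
      simp only [neg_neg]; positivity)
  linarith

/-- As a function of `-t²`, the profile is concave; this is the tangent line inequality. -/
lemma profile_le_tangent {s t : ℝ} (hs : 0 ≤ s) (ht : 0 ≤ t) :
    profile t ≤ profile s + Real.exp s / 2 * (s ^ 2 - t ^ 2) := by
  have hd : ∀ x : ℝ, HasDerivAt (fun x => Real.exp s / 2 * (s ^ 2 - x ^ 2) - profile x)
      (x * (Real.exp x - Real.exp s)) x := by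
    intro x
    have := (((hasDerivAt_pow 2 x).const_sub (s ^ 2)).const_mul (Real.exp s / 2)).sub
      (hasDerivAt_profile x)
    refine this.congr_deriv ?_
    simp; ring
  rcases le_total s t with h | h
  · have := le_of_hasDerivAt_nonneg h (fun x _ => hd x) (fun x hx => by
      have h1 := Real.exp_le_exp.2 hx.1
      have : 0 ≤ x := hs.trans hx.1
      exact mul_nonneg this (by linarith))
    simp only [sub_self, mul_zero] at this
    linarith
  · have := le_of_hasDerivAt_nonneg h (fun x _ => (hd x).neg) (fun x hx => by
      have h1 := Real.exp_le_exp.2 hx.2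
      have : 0 ≤ x := ht.trans hx.1
      nlinarith)
    simp only [sub_self, mul_zero, Pi.neg_apply] at this
    linarith

/-- `(1 - z) e^{2z} < 1 + z` for `z > 0`. -/
lemma one_sub_mul_exp_lt {z : ℝ} (hz : 0 < z) : (1 - z) * Real.exp (2 * z) < 1 + z := by
  have hd : ∀ x : ℝ, HasDerivAt (fun x => (1 + x) * Real.exp (-x) - (1 - x) * Real.exp x)
      (x * (Real.exp x - Real.exp (-x))) x := by
    intro x
    have h1 := ((hasDerivAt_id x).const_add 1).mul ((hasDerivAt_id x).neg.exp)
    have h2 := hasDerivAt_profile x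
    refine (h1.sub h2).congr_deriv ?_
    simp; ring
  have := lt_of_hasDerivAt_pos hz (fun x _ => hd x) (fun x hx => by
    have : Real.exp (-x) < Real.exp x := Real.exp_lt_exp.2 (by linarith [hx.1])
    exact mul_pos hx.1 (by linarith))
  simp only [add_zero, neg_zero, Real.exp_zero, mul_one, sub_zero, sub_self] at this
  have e1 : Real.exp (2 * z) = Real.exp z * Real.exp z := by rw [← Real.exp_add]; ring_nf
  have e2 : Real.exp z * Real.exp (-z) = 1 := by rw [← Real.exp_add]; simp
  have := mul_pos (Real.exp_pos z) this
  rw [e1]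
  nlinarith

/-- The reciprocal of `K`: `(e^{bε} - b² e^{ε/b}) / (1 - b²)` increases with `b ∈ (0,1)`. -/
lemma kappa_mono {a b ε : ℝ} (ha : 0 < a) (hab : a ≤ b) (hb : b < 1) (hε : 0 < ε) :
    (Real.exp (a * ε) - a ^ 2 * Real.exp (ε / a)) / (1 - a ^ 2) ≤
      (Real.exp (b * ε) - b ^ 2 * Real.exp (ε / b)) / (1 - b ^ 2) := by
  have hd : ∀ x ∈ Icc a b, HasDerivAt
      (fun x => (Real.exp (x * ε) - x ^ 2 * Real.exp (ε / x)) / (1 - x ^ 2))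
      (Real.exp (x * ε) * (2 * x) * ((1 + (1 - x ^ 2) * ε / (2 * x)) -
        (1 - (1 - x ^ 2) * ε / (2 * x)) * Real.exp (2 * ((1 - x ^ 2) * ε / (2 * x))))
        / (1 - x ^ 2) ^ 2) x := by
    intro x hx
    have hx0 : 0 < x := ha.trans_le hx.1
    have hx1 : x < 1 := hx.2.trans_lt hb
    have hne : (1 - x ^ 2) ≠ 0 := by nlinarith
    have h1 := ((hasDerivAt_id x).mul_const ε).exp
    have h2 := (hasDerivAt_pow 2 x).mul (((hasDerivAt_inv hx0.ne').const_mul ε).exp)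
    have h3 := (hasDerivAt_pow 2 x).const_sub 1
    have h4 := (h1.sub h2).div h3 hne
    have e1 : Real.exp (2 * ((1 - x ^ 2) * ε / (2 * x))) =
        Real.exp (ε / x) * (Real.exp (x * ε))⁻¹ := by
      rw [← Real.exp_neg, ← Real.exp_add]
      congr 1
      field_simp
      ring
    have h5 := h4.congr_deriv (g' := Real.exp (x * ε) * (2 * x) * ((1 + (1 - x ^ 2) * ε / (2 * x)) -
        (1 - (1 - x ^ 2) * ε / (2 * x)) * Real.exp (2 * ((1 - x ^ 2) * ε / (2 * x))))
        / (1 - x ^ 2) ^ 2) (by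
      rw [e1]
      simp only [id, div_eq_mul_inv, Pi.mul_apply, Pi.sub_apply]
      have := Real.exp_pos (x * ε)
      field_simp
      push_cast
      ring)
    simp only [div_eq_mul_inv] at h5 ⊢
    exact h5
  refine le_of_hasDerivAt_nonneg hab hd (fun x hx => ?_)
  have hx0 : 0 < x := ha.trans_le hx.1
  have hx1 : x < 1 := hx.2.trans_lt hb
  have hz : 0 < (1 - x ^ 2) * ε / (2 * x) := by
    have : 0 < 1 - x ^ 2 := by nlinarith
    positivity
  have := one_sub_mul_exp_lt hz
  have h6 : 0 ≤ ((1 + (1 - x ^ 2) * ε / (2 * x)) -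
        (1 - (1 - x ^ 2) * ε / (2 * x)) * Real.exp (2 * ((1 - x ^ 2) * ε / (2 * x)))) := by linarith
  positivity

/-! ### Concavity of the candidate along chords

A chord has a left endpoint of weight `1 - β` and a right endpoint of weight `β` at the horizontal
distance `D ≥ 0`. The numbers `rm`, `rp` and `r` are the values of `√(δ² - V)` at the left endpoint,
at the right endpoint and at their weighted mean.
-/

/-- The case in which the extremal tangent through the middle point, along which the candidate is
affine, extends over the whole horizontal extent of the chord: `profile_le_tangent` compares the
endpoints with the points of that tangent above or below them. -/
lemma chord_of_le {β D r rp rm : ℝ} (hβ0 : 0 ≤ β) (hβ1 : β ≤ 1) (hD : 0 ≤ D)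
    (hrp : 0 ≤ rp) (hrm : 0 ≤ rm) (hr : (1 - β) * D ≤ r)
    (hrel : β * rp ^ 2 + (1 - β) * rm ^ 2 = r ^ 2 + β * (1 - β) * D ^ 2) :
    β * (profile rp * Real.exp D) + (1 - β) * profile rm ≤ profile r * Real.exp (β * D) := by
  have hr0 : 0 ≤ r := le_trans (mul_nonneg (by linarith) hD) hr
  have h1 := profile_le_tangent (s := r - (1 - β) * D) (t := rp) (by linarith) hrp
  have h2 := profile_le_tangent (s := r + β * D) (t := rm) (by positivity) hrm
  have e1 : Real.exp (r - (1 - β) * D) * Real.exp D = Real.exp r * Real.exp (β * D) := by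
    rw [← Real.exp_add, ← Real.exp_add]; ring_nf
  have e2 : Real.exp (r + β * D) = Real.exp r * Real.exp (β * D) := by
    rw [← Real.exp_add]
  unfold profile at *
  rw [e2] at h2
  have h1' : (1 - rp) * Real.exp rp * Real.exp D ≤
      Real.exp r * Real.exp (β * D) * (1 - (r - (1 - β) * D) +
        ((r - (1 - β) * D) ^ 2 - rp ^ 2) / 2) := by
    calc _ ≤ _ := mul_le_mul_of_nonneg_right h1 (Real.exp_pos D).le
      _ = _ := by rw [← e1]; ring
  have h3 := add_le_add (mul_le_mul_of_nonneg_left h1' hβ0)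
    (mul_le_mul_of_nonneg_left h2 (by linarith : 0 ≤ 1 - β))
  refine h3.trans (le_of_eq ?_)
  have : (1 - β) * rm ^ 2 = r ^ 2 + β * (1 - β) * D ^ 2 - β * rp ^ 2 := by linarith
  linear_combination (-Real.exp r * Real.exp (β * D) / 2) * this

/-- The quotient whose comparison with `profile ρ` decides the monotonicity in `D` of the
boundary chord inequality. -/
lemma boundary_quotient_anti {β ρ D₁ D₂ : ℝ} (hβ0 : 0 < β) (hβ1 : β < 1) (hρ : 0 < ρ)
    (hD₁ : 0 < D₁) (hD : D₁ ≤ D₂) :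
    D₂ * Real.exp √(ρ ^ 2 + β * D₂ ^ 2) / (Real.exp D₂ - Real.exp (β * D₂)) ≤
      D₁ * Real.exp √(ρ ^ 2 + β * D₁ ^ 2) / (Real.exp D₁ - Real.exp (β * D₁)) := by
  have hY : ∀ x : ℝ, 0 < x → 0 < Real.exp x - Real.exp (β * x) := fun x hx =>
    sub_pos.2 (Real.exp_lt_exp.2 (by nlinarith))
  have hR : ∀ x : ℝ, 0 < ρ ^ 2 + β * x ^ 2 := fun x => by positivity
  have hd : ∀ x ∈ Icc D₁ D₂, HasDerivAt
      (fun x => x * Real.exp √(ρ ^ 2 + β * x ^ 2) / (Real.exp x - Real.exp (β * x)))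
      (Real.exp √(ρ ^ 2 + β * x ^ 2) *
        ((1 + β * x / √(ρ ^ 2 + β * x ^ 2) * x) * (Real.exp x - Real.exp (β * x)) -
          x * (Real.exp x - β * Real.exp (β * x))) / (Real.exp x - Real.exp (β * x)) ^ 2) x := by
    intro x hx
    have hx0 : 0 < x := hD₁.trans_le hx.1
    have h1 := (((hasDerivAt_pow 2 x).const_mul β).const_add (ρ ^ 2)).sqrt (hR x).ne'
    have h2 := (hasDerivAt_id x).mul h1.exp
    have h3 := (Real.hasDerivAt_exp x).sub ((hasDerivAt_id x).const_mul β).exp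
    refine (h2.div h3 (hY x hx0).ne').congr_deriv ?_
    have := Real.sqrt_pos.2 (hR x)
    simp only [id, Pi.mul_apply, Pi.sub_apply]
    congr 1
    field_simp
    push_cast
    ring
  have := le_of_hasDerivAt_nonneg hD (fun x hx => (hd x hx).neg) (fun x hx => by
    have hx0 : 0 < x := hD₁.trans_le hx.1
    have hRx := Real.sqrt_pos.2 (hR x)
    have hq : 0 < (1 - β) * x / 2 := by
      have : 0 < 1 - β := by linarith
      positivity
    have h1 := one_sub_mul_exp_lt hq
    have e1 : Real.exp x = Real.exp (β * x) * Real.exp (2 * ((1 - β) * x / 2)) := by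
      rw [← Real.exp_add]; ring_nf
    have h2 : (1 + (1 + β) / 2 * x) * (Real.exp x - Real.exp (β * x)) ≤
        x * (Real.exp x - β * Real.exp (β * x)) := by
      rw [e1]
      have := mul_le_mul_of_nonneg_left h1.le (Real.exp_pos (β * x)).le
      linarith
    -- Here `β x / R ≤ √β ≤ (1 + β) / 2`.
    have h3 : β * x / √(ρ ^ 2 + β * x ^ 2) ≤ (1 + β) / 2 := by
      rw [div_le_iff₀ hRx]
      apply le_of_sq_le_sq _ (by positivity)
      rw [mul_pow, mul_pow, Real.sq_sqrt (hR x).le]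
      nlinarith [mul_nonneg (sq_nonneg (1 - β)) (mul_nonneg hβ0.le (sq_nonneg x)),
        mul_nonneg (sq_nonneg (1 + β)) (sq_nonneg ρ)]
    have h4 : (1 + β * x / √(ρ ^ 2 + β * x ^ 2) * x) * (Real.exp x - Real.exp (β * x)) ≤
        (1 + (1 + β) / 2 * x) * (Real.exp x - Real.exp (β * x)) := by
      apply mul_le_mul_of_nonneg_right _ (hY x hx0).le
      have := mul_le_mul_of_nonneg_right h3 hx0.le
      linarith
    rw [← neg_div, neg_mul_eq_mul_neg]
    apply div_nonneg _ (sq_nonneg _)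
    apply mul_nonneg (Real.exp_pos _).le
    linarith)
  simp only [Pi.neg_apply] at this
  linarith

/-- The chord inequality when the middle and the right point both lie on the upper boundary
of the strip. Its defect, as a function of the length `D` of the chord, first increases and then
decreases, so that only the endpoints `0` and `D₁` matter. -/
lemma boundary_chord {β ρ D D₁ : ℝ} (hβ0 : 0 < β) (hβ1 : β < 1) (hρ : 0 < ρ)
    (hD0 : 0 ≤ D) (hD : D ≤ D₁)
    (hend : (1 - β) * profile √(ρ ^ 2 + β * D₁ ^ 2) ≤
      profile ρ * (Real.exp (β * D₁) - β * Real.exp D₁)) :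
    (1 - β) * profile √(ρ ^ 2 + β * D ^ 2) ≤
      profile ρ * (Real.exp (β * D) - β * Real.exp D) := by
  set Φ : ℝ → ℝ := fun x => profile ρ * (Real.exp (β * x) - β * Real.exp x) -
    (1 - β) * profile √(ρ ^ 2 + β * x ^ 2) with hΦ
  have hR : ∀ x : ℝ, 0 < ρ ^ 2 + β * x ^ 2 := fun x => by positivity
  have hd : ∀ x, HasDerivAt Φ (β * ((1 - β) * (x * Real.exp √(ρ ^ 2 + β * x ^ 2)) -
      profile ρ * (Real.exp x - Real.exp (β * x)))) x := by
    intro x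
    have h1 := (((hasDerivAt_pow 2 x).const_mul β).const_add (ρ ^ 2)).sqrt (hR x).ne'
    have h2 := (hasDerivAt_profile √(ρ ^ 2 + β * x ^ 2)).comp x h1
    have h3 := ((hasDerivAt_id x).const_mul β).exp.sub ((Real.hasDerivAt_exp x).const_mul β)
    refine ((h3.const_mul (profile ρ)).sub (h2.const_mul (1 - β))).congr_deriv ?_
    have := Real.sqrt_pos.2 (hR x)
    simp only [id]
    field_simp
    push_cast
    ring
  have hY : ∀ x : ℝ, 0 < x → 0 < Real.exp x - Real.exp (β * x) := fun x hx =>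
    sub_pos.2 (Real.exp_lt_exp.2 (by nlinarith))
  have hsign : ∀ x y : ℝ, 0 < x → x ≤ y →
      0 ≤ (1 - β) * (y * Real.exp √(ρ ^ 2 + β * y ^ 2)) -
        profile ρ * (Real.exp y - Real.exp (β * y)) →
      0 ≤ (1 - β) * (x * Real.exp √(ρ ^ 2 + β * x ^ 2)) -
        profile ρ * (Real.exp x - Real.exp (β * x)) := by
    intro x y hx hxy h
    have h1 := boundary_quotient_anti hβ0 hβ1 hρ hx hxy
    have hYx := hY x hx
    have hYy := hY y (hx.trans_le hxy)
    have h2 : profile ρ ≤ (1 - β) * (y * Real.exp √(ρ ^ 2 + β * y ^ 2) /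
        (Real.exp y - Real.exp (β * y))) := by
      rw [← mul_div_assoc, le_div_iff₀ hYy]; linarith
    have h3 := h2.trans (mul_le_mul_of_nonneg_left h1 (by linarith))
    rw [← mul_div_assoc, le_div_iff₀ hYx] at h3
    linarith
  suffices h : 0 ≤ Φ D by simp only [hΦ] at h; linarith
  rcases hD0.eq_or_lt with rfl | hDpos
  · simp [hΦ, Real.sqrt_sq hρ.le]; linarith
  by_cases hs : 0 ≤ (1 - β) * (D * Real.exp √(ρ ^ 2 + β * D ^ 2)) -
      profile ρ * (Real.exp D - Real.exp (β * D))
  · have h0 : Φ 0 = 0 := by simp [hΦ, Real.sqrt_sq hρ.le]; ring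
    rw [← h0]
    refine le_of_hasDerivAt_nonneg hD0 (fun x _ => hd x) (fun x hx => ?_)
    rcases hx.1.eq_or_lt with rfl | hx0
    · simp
    · exact mul_nonneg hβ0.le (hsign x D hx0 hx.2 hs)
  · have h1 : 0 ≤ Φ D₁ := by simp only [hΦ]; linarith
    have := le_of_hasDerivAt_nonneg hD (fun x _ => (hd x).neg) (fun x hx => by
      by_contra hc
      apply hs
      apply hsign D x hDpos hx.1
      by_contra hc'
      apply hc
      have := mul_nonneg hβ0.le (neg_nonneg.2 (not_le.1 hc').le)
      linarith)
    simp only [Pi.neg_apply] at this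
    linarith

/-- The data of the candidate: `0 < ρ < δ`, `δ² = ρ² + ε²`, and the inequality at the extremal
splitting of a point of the upper boundary, for every splitting ratio `β ∈ [α, 1)`. -/
structure CandidateData (α ε ρ δ : ℝ) : Prop where
  α_pos : 0 < α
  ε_pos : 0 < ε
  ρ_pos : 0 < ρ
  δ_pos : 0 < δ
  sq_eq : δ ^ 2 = ρ ^ 2 + ε ^ 2
  extremal : ∀ β, α ≤ β → β < 1 →
    (1 - β) * profile δ ≤ profile ρ * (Real.exp (√β * ε) - β * Real.exp (ε / √β))

/-- The chord inequality when the right endpoint lies on the upper boundary. -/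
lemma chord_of_top {α ε ρ δ β D r rm : ℝ} (h : CandidateData α ε ρ δ) (hαβ : α ≤ β) (hβ1 : β < 1)
    (hD : 0 ≤ D) (hrmρ : ρ ≤ rm) (hrmδ : rm ≤ δ) (hr : ρ ≤ r)
    (hrel : β * ρ ^ 2 + (1 - β) * rm ^ 2 = r ^ 2 + β * (1 - β) * D ^ 2) :
    β * (profile ρ * Real.exp D) + (1 - β) * profile rm ≤ profile r * Real.exp (β * D) := by
  have hρ := h.ρ_pos
  have hβ0 : 0 < β := h.α_pos.trans_le hαβ
  have hβ' : 0 < 1 - β := by linarith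
  by_cases hc : (1 - β) * D ≤ r
  · exact chord_of_le hβ0.le hβ1.le hD hρ.le (by linarith) hc hrel
  push Not at hc
  have hDpos : 0 < D := by
    by_contra hD'
    have : D = 0 := by linarith
    subst this
    linarith
  -- The point of the chord with parameter `θ` is the first one on the upper boundary.
  set θ := (rm ^ 2 - ρ ^ 2) / D ^ 2 with hθ
  have hθD : θ * D ^ 2 = rm ^ 2 - ρ ^ 2 := by rw [hθ]; field_simp
  clear_value θ
  have hD2 : 0 < D ^ 2 := by positivity
  have hrel' : (1 - β) * ((θ - β) * D ^ 2) = r ^ 2 - ρ ^ 2 := by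
    linear_combination hrel + (1 - β) * hθD
  have hθβ : β ≤ θ := by
    have h1 : 0 ≤ r ^ 2 - ρ ^ 2 := by nlinarith
    rw [← hrel'] at h1
    have h2 := nonneg_of_mul_nonneg_right h1 hβ'
    have h3 := nonneg_of_mul_nonneg_left h2 hD2
    linarith
  have hθ1 : θ < 1 := by
    have h1 : r ^ 2 < ((1 - β) * D) ^ 2 := by
      apply pow_lt_pow_left₀ hc (by linarith) (by norm_num)
    have h2 : (1 - β) * ((θ - β) * D ^ 2) < (1 - β) * ((1 - β) * D ^ 2) := by nlinarith
    have h3 := lt_of_mul_lt_mul_left h2 hβ'.le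
    have h4 := lt_of_mul_lt_mul_right h3 hD2.le
    linarith
  have hθ0 : 0 < θ := by linarith
  have hsqθ : 0 < √θ := Real.sqrt_pos.2 hθ0
  have hsq2 : √θ ^ 2 = θ := Real.sq_sqrt hθ0.le
  have key : (1 - θ) * profile rm ≤ profile ρ * (Real.exp (θ * D) - θ * Real.exp D) := by
    have h1 : D ≤ ε / √θ := by
      rw [le_div_iff₀ hsqθ]
      apply le_of_sq_le_sq _ h.ε_pos.le
      rw [mul_pow, hsq2]
      have := h.sq_eq
      nlinarith
    have h2 : √(ρ ^ 2 + θ * (ε / √θ) ^ 2) = δ := by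
      rw [div_pow, hsq2, mul_div_cancel₀ _ hθ0.ne', ← h.sq_eq, Real.sqrt_sq h.δ_pos.le]
    have h3 : θ * (ε / √θ) = √θ * ε := by
      rw [← mul_div_assoc, div_eq_iff hsqθ.ne']
      rw [mul_right_comm, ← sq, hsq2]
    have h4 := boundary_chord hθ0 hθ1 hρ hD h1 (by
      rw [h2, h3]
      exact h.extremal θ (hαβ.trans hθβ) hθ1)
    rwa [hθD, add_sub_cancel, Real.sqrt_sq (by linarith)] at h4
  have hb : β / θ ≤ 1 := (div_le_one hθ0).2 hθβ
  have h5 := chord_of_le (β := β / θ) (D := θ * D) (r := r) (rp := ρ) (rm := rm)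
    (by positivity) hb (by positivity) hρ.le (by linarith) (by
      have e : (1 - β / θ) * (θ * D) = (θ - β) * D := by field_simp
      rw [e]
      apply le_of_sq_le_sq _ (by linarith)
      have : 0 ≤ (θ - β) * D ^ 2 * (1 - θ) :=
        mul_nonneg (mul_nonneg (by linarith) hD2.le) (by linarith)
      nlinarith [sq_nonneg ρ]) (by
      have e : β / θ * (1 - β / θ) * (θ * D) ^ 2 = β * (θ - β) * D ^ 2 := by field_simp
      rw [e]
      have e2 : β / θ * θ = β := by field_simp
      linear_combination hrel + (β / θ - β) * hθD - D ^ 2 * e2)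
  have e3 : β / θ * (θ * D) = β * D := by field_simp
  rw [e3] at h5
  have h6 := mul_le_mul_of_nonneg_left key (by positivity : 0 ≤ β / θ)
  have e4 : β / θ * ((1 - θ) * profile rm) = (β / θ - β) * profile rm := by field_simp
  have e5 : β / θ * (profile ρ * (Real.exp (θ * D) - θ * Real.exp D)) =
    β / θ * (profile ρ * Real.exp (θ * D)) - β * (profile ρ * Real.exp D) := by field_simp
  rw [e4, e5] at h6
  linarith

/-- The chord inequality for all chords whose endpoints and middle point lie in the strip. -/
lemma chord_le {α ε ρ δ β D r rp rm : ℝ} (h : CandidateData α ε ρ δ) (hαβ : α ≤ β) (hβ1 : β < 1)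
    (hD : 0 ≤ D) (hrp : ρ ≤ rp) (hrmρ : ρ ≤ rm) (hrmδ : rm ≤ δ) (hr : ρ ≤ r)
    (hrel : β * rp ^ 2 + (1 - β) * rm ^ 2 = r ^ 2 + β * (1 - β) * D ^ 2) :
    β * (profile rp * Real.exp D) + (1 - β) * profile rm ≤ profile r * Real.exp (β * D) := by
  have hρ := h.ρ_pos
  have hβ0 : 0 < β := h.α_pos.trans_le hαβ
  have hβ' : 0 < 1 - β := by linarith
  by_cases hc : (1 - β) * D ≤ r
  · exact chord_of_le hβ0.le hβ1.le hD (by linarith) (by linarith) hc hrel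
  push Not at hc
  -- Shorten the chord, increasing the variance of its right endpoint so that the variances of the
  -- middle point and of the left endpoint are kept, until a previous case applies at length `D₀`.
  set P : ℝ → ℝ := fun x => rp ^ 2 - (1 - β) * (D ^ 2 - x ^ 2) with hP
  set M := max ((r / (1 - β)) ^ 2) (D ^ 2 - (rp ^ 2 - ρ ^ 2) / (1 - β)) with hM
  have hM0 : 0 ≤ M := (sq_nonneg _).trans (le_max_left _ _)
  set D₀ := √M with hD₀
  have hD₀0 : 0 ≤ D₀ := Real.sqrt_nonneg _
  have hD₀2 : D₀ ^ 2 = M := Real.sq_sqrt hM0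
  have hrd : r / (1 - β) ≤ D₀ := Real.le_sqrt_of_sq_le (le_max_left _ _)
  have hD₀D : D₀ ≤ D := by
    rw [hD₀, Real.sqrt_le_left hD]
    apply max_le
    · apply pow_le_pow_left₀ (div_nonneg (by linarith) hβ'.le)
      rw [div_le_iff₀ hβ']; linarith
    · have : 0 ≤ (rp ^ 2 - ρ ^ 2) / (1 - β) := div_nonneg (by nlinarith) hβ'.le
      linarith
  have hPge : ∀ x, D₀ ≤ x → ρ ^ 2 ≤ P x := by
    intro x hx
    have h1 : D ^ 2 - (rp ^ 2 - ρ ^ 2) / (1 - β) ≤ x ^ 2 :=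
      (le_max_right _ _).trans (hD₀2.symm.le.trans (pow_le_pow_left₀ hD₀0 hx 2))
    have h2 := mul_le_mul_of_nonneg_left h1 hβ'.le
    rw [mul_sub, mul_div_cancel₀ _ hβ'.ne'] at h2
    simp only [hP]; linarith
  have hPpos : ∀ x, D₀ ≤ x → 0 < P x := fun x hx => lt_of_lt_of_le (by positivity) (hPge x hx)
  have hd : ∀ x ∈ Icc D₀ D, HasDerivAt
      (fun x => profile r * Real.exp (β * x) - β * (profile √(P x) * Real.exp x))
      (β * Real.exp (β * x) * (profile r - profile (√(P x) + (1 - β) * x))) x := by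
    intro x hx
    have hPd : HasDerivAt P ((1 - β) * (2 * x)) x := by
      have := (((hasDerivAt_pow 2 x).const_sub (D ^ 2)).const_mul (1 - β)).const_sub (rp ^ 2)
      refine this.congr_deriv ?_
      push_cast; ring
    have h1 := hPd.sqrt (hPpos x hx.1).ne'
    have h2 := ((hasDerivAt_profile √(P x)).comp x h1).mul (Real.hasDerivAt_exp x)
    have h3 := ((hasDerivAt_id x).const_mul β).exp
    refine ((h3.const_mul (profile r)).sub (h2.const_mul β)).congr_deriv ?_
    have := Real.sqrt_pos.2 (hPpos x hx.1)
    have e1 : Real.exp x = Real.exp (β * x) * Real.exp ((1 - β) * x) := by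
      rw [← Real.exp_add]; ring_nf
    simp only [id, Function.comp, e1, profile, Real.exp_add]
    field_simp
    ring
  have hmono := le_of_hasDerivAt_nonneg hD₀D hd (fun x hx => by
    apply mul_nonneg (by positivity)
    have h1 : r ≤ (1 - β) * x := by
      have := hrd.trans hx.1
      rw [div_le_iff₀ hβ'] at this
      linarith
    have h2 := profile_anti (by linarith : 0 ≤ r)
      (by linarith [Real.sqrt_nonneg (P x)] : r ≤ √(P x) + (1 - β) * x)
    linarith)
  have hPD : √(P D) = rp := by simp [hP, Real.sqrt_sq (by linarith : 0 ≤ rp)]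
  have hP0 : √(P D₀) ^ 2 = P D₀ := Real.sq_sqrt (hPpos _ le_rfl).le
  have hrel0 : β * √(P D₀) ^ 2 + (1 - β) * rm ^ 2 = r ^ 2 + β * (1 - β) * D₀ ^ 2 := by
    rw [hP0]; simp only [hP]; linear_combination hrel
  have hfin : β * (profile √(P D₀) * Real.exp D₀) + (1 - β) * profile rm ≤
      profile r * Real.exp (β * D₀) := by
    rcases le_total ((r / (1 - β)) ^ 2) (D ^ 2 - (rp ^ 2 - ρ ^ 2) / (1 - β)) with hm | hm
    · have : P D₀ = ρ ^ 2 := by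
        simp only [hP]
        rw [hD₀2, hM, max_eq_right hm]
        field_simp
        ring
      rw [this, Real.sqrt_sq hρ.le] at hrel0 ⊢
      exact chord_of_top h hαβ hβ1 hD₀0 hrmρ hrmδ hr hrel0
    · apply chord_of_le hβ0.le hβ1.le hD₀0 (Real.sqrt_nonneg _) (by linarith) _ hrel0
      rw [hD₀, hM, max_eq_left hm, Real.sqrt_sq (div_nonneg (by linarith) hβ'.le),
        mul_div_cancel₀ _ hβ'.ne']
  simp only [hPD] at hmono
  linarith

/-! ### The number `δ(α, ε)` -/

/-- The range of `ε` for which the extremal functions of the Bellman problem have finite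
exponential averages; equivalently, the denominator of `K α ε` is positive. -/
def Subcritical (α ε : ℝ) : Prop := α * Real.exp (ε / √α) < Real.exp (√α * ε)

lemma kappa_lt_profile {a ε : ℝ} (ha0 : 0 < a) (ha1 : a < 1) (hε : 0 < ε) :
    Real.exp (a * ε) - a ^ 2 * Real.exp (ε / a) < (1 - a ^ 2) * profile ε := by
  have hd : ∀ x ∈ Icc 0 ε, HasDerivAt
      (fun x => a ^ 2 * Real.exp (x / a) - Real.exp (a * x) + (1 - a ^ 2) * profile x)
      (a * Real.exp (x / a) - a * Real.exp (a * x) - (1 - a ^ 2) * (x * Real.exp x)) x := by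
    intro x _
    have h1 := (((hasDerivAt_id x).div_const a).exp).const_mul (a ^ 2)
    have h2 := ((hasDerivAt_id x).const_mul a).exp
    refine ((h1.sub h2).add ((hasDerivAt_profile x).const_mul (1 - a ^ 2))).congr_deriv ?_
    simp only [id]
    field_simp
    ring
  have := lt_of_hasDerivAt_pos hε hd (fun x hx => by
    set p := (1 - a) * x / a with hp
    have hp0 : 0 < p := div_pos (mul_pos (by linarith) hx.1) ha0
    have hpx : a * p = (1 - a) * x := by rw [hp]; field_simp
    have e1 : Real.exp (x / a) = Real.exp x * Real.exp p := by
      rw [← Real.exp_add, hp]; congr 1; field_simp; ring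
    have e2 : Real.exp (a * x) = Real.exp x * Real.exp (-(a * p)) := by
      rw [← Real.exp_add, hpx]; congr 1; ring
    have h1 := Real.quadratic_le_exp_of_nonneg hp0.le
    have h2 : Real.exp (-(a * p)) ≤ 1 - a * p + (a * p) ^ 2 / 2 := by
      have hq := Real.quadratic_le_exp_of_nonneg (mul_pos ha0 hp0).le
      rw [Real.exp_neg, inv_le_iff_one_le_mul₀ (Real.exp_pos _)]
      have h0 : 0 ≤ 1 - a * p + (a * p) ^ 2 / 2 := by nlinarith [sq_nonneg (a * p - 1)]
      have := mul_le_mul_of_nonneg_left hq h0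
      nlinarith [sq_nonneg ((a * p) ^ 2)]
    rw [e1, e2]
    have h3 : 0 < p ^ 2 * (1 - a ^ 2) := mul_pos (by positivity) (by nlinarith)
    have h4 : (1 + a) * p < Real.exp p - Real.exp (-(a * p)) := by nlinarith
    have h5 := mul_lt_mul_of_pos_left h4 (mul_pos ha0 (Real.exp_pos x))
    have e3 : a * Real.exp x * ((1 + a) * p) = (1 - a ^ 2) * (x * Real.exp x) := by
      linear_combination (1 + a) * Real.exp x * hpx
    rw [e3] at h5
    linarith)
  simp [profile] at this
  unfold profile
  linarith

lemma profile_pos {t : ℝ} (ht : t < 1) : 0 < profile t :=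
  mul_pos (by linarith) (Real.exp_pos t)

lemma g_eq_zero_iff {α δ ε : ℝ} (hδ : δ < 1) :
    g α δ ε = 0 ↔ profile √(δ ^ 2 - ε ^ 2) = K α ε * profile δ := by
  have h1 : (1 - √(δ ^ 2 - ε ^ 2)) / (1 - δ) * Real.exp (-δ + √(δ ^ 2 - ε ^ 2)) =
      profile √(δ ^ 2 - ε ^ 2) / profile δ := by
    unfold profile
    rw [Real.exp_add, Real.exp_neg]
    have : 1 - δ ≠ 0 := by linarith
    field_simp
  rw [g, h1, sub_eq_zero, div_eq_iff (profile_pos hδ).ne']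

lemma profile_ratio_strictMono {ε x y : ℝ} (hε : 0 < ε) (hx : ε < x) (hxy : x < y) (hy : y < 1) :
    profile √(x ^ 2 - ε ^ 2) / profile x < profile √(y ^ 2 - ε ^ 2) / profile y := by
  have hpos : ∀ t ∈ Icc x y, 0 < t ^ 2 - ε ^ 2 := fun t ht => by
    nlinarith [hx.trans_le ht.1]
  refine lt_of_hasDerivAt_pos (f := fun t => profile √(t ^ 2 - ε ^ 2) / profile t)
    (f' := fun t => t * Real.exp (√(t ^ 2 - ε ^ 2) + t) * (t - √(t ^ 2 - ε ^ 2)) /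
      profile t ^ 2) hxy (fun t ht => ?_) (fun t ht => ?_)
  · have ht1 : t < 1 := ht.2.trans_lt hy
    have h1 := ((hasDerivAt_pow 2 t).sub_const (ε ^ 2)).sqrt (hpos t ht).ne'
    have h2 := (hasDerivAt_profile √(t ^ 2 - ε ^ 2)).comp t h1
    refine (h2.div (hasDerivAt_profile t) (profile_pos ht1).ne').congr_deriv ?_
    have := Real.sqrt_pos.2 (hpos t ht)
    congr 1
    simp only [Function.comp, profile, Real.exp_add]
    field_simp
    push_cast
    ring
  · have ht0 : 0 < t := hε.trans (hx.trans ht.1)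
    have h1 : √(t ^ 2 - ε ^ 2) < t := by
      rw [Real.sqrt_lt' ht0]; nlinarith
    have := profile_pos (ht.2.trans hy)
    have : 0 < t - √(t ^ 2 - ε ^ 2) := by linarith
    positivity

theorem existsUnique_isDelta {α ε : ℝ} (hα0 : 0 < α) (hα1 : α < 1) (hε : 0 < ε)
    (hs : Subcritical α ε) : ∃! δ : ℝ, IsDelta α ε δ := by
  set a := √α with ha
  have ha0 : 0 < a := Real.sqrt_pos.2 hα0
  have ha2 : α = a ^ 2 := (Real.sq_sqrt hα0.le).symm
  have ha1 : a < 1 := by nlinarith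
  have hden : 0 < Real.exp (a * ε) - α * Real.exp (ε / a) := sub_pos.2 hs
  have hα1' : 0 < 1 - α := by linarith
  have hK : K α ε = (1 - α) / (Real.exp (a * ε) - α * Real.exp (ε / a)) := rfl
  have hkl := kappa_lt_profile ha0 ha1 hε
  rw [← ha2] at hkl
  have hε1 : ε < 1 := by
    have h1 := pos_of_mul_pos_right (hden.trans hkl) hα1'.le
    have h2 := pos_of_mul_pos_left h1 (Real.exp_pos ε).le
    linarith
  have hmin : ε < (1 + α) / (2 * a) * ε := by
    have : 1 < (1 + α) / (2 * a) := by
      rw [one_lt_div (by positivity)]; nlinarith [sq_nonneg (1 - a)]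
    nlinarith
  set m := min 1 ((1 + α) / (2 * a) * ε) with hm
  have hεm : ε < m := lt_min hε1 hmin
  set G : ℝ → ℝ := fun x => profile √(x ^ 2 - ε ^ 2) - K α ε * profile x with hG
  have hGc : Continuous G := by
    have : Continuous profile := continuous_iff_continuousAt.2
      fun x => (hasDerivAt_profile x).continuousAt
    simp only [hG]; fun_prop
  have hGε : G ε < 0 := by
    simp only [hG, sub_self, Real.sqrt_zero]
    rw [hK, sub_neg, div_mul_eq_mul_div, lt_div_iff₀ hden]
    simpa [profile] using hkl
  have hGm : 0 < G m := by
    rcases le_total 1 ((1 + α) / (2 * a) * ε) with h | h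
    · rw [hm, min_eq_left h]
      have : profile 1 = 0 := by simp [profile]
      simp only [hG, this, mul_zero, sub_zero]
      apply profile_pos
      rw [Real.sqrt_lt' one_pos]
      nlinarith
    · rw [hm, min_eq_right h]
      set r := (1 - α) / (2 * a) * ε with hr
      have hr0 : 0 < r := by positivity
      have hsq : √(((1 + α) / (2 * a) * ε) ^ 2 - ε ^ 2) = r := by
        rw [← Real.sqrt_sq hr0.le]
        congr 1
        rw [hr, ha2]
        field_simp
        ring
      have hδr : (1 + α) / (2 * a) * ε = r + a * ε := by
        rw [hr, ha2]; field_simp; ring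
      have hδr' : (1 - α) * ((1 + α) / (2 * a) * ε) = (1 + α) * r := by
        rw [hr]; ring
      have e1 : Real.exp (ε / a) = Real.exp (a * ε) * Real.exp (2 * r) := by
        rw [← Real.exp_add, hr, ha2]
        congr 1
        field_simp
        ring
      simp only [hG, hsq]
      rw [sub_pos, hK, div_mul_eq_mul_div, div_lt_iff₀ hden]
      have h1 := one_sub_mul_exp_lt hr0
      have h2 : (1 - α) * (1 - (1 + α) / (2 * a) * ε) < (1 - r) * (1 - α * Real.exp (2 * r)) := by
        nlinarith
      have h3 := mul_lt_mul_of_pos_right h2 (Real.exp_pos (r + a * ε))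
      unfold profile
      rw [e1]
      conv_lhs => rw [hδr]
      rw [hδr] at h3
      calc _ = _ := by ring
        _ < _ := h3
        _ = _ := by rw [Real.exp_add]; ring
  obtain ⟨δ, ⟨hδ1, hδ2⟩, hδ0⟩ := intermediate_value_Ioo hεm.le hGc.continuousOn ⟨hGε, hGm⟩
  refine ⟨δ, ⟨?_, hδ1, hδ2⟩, ?_⟩
  · rw [g_eq_zero_iff (hδ2.trans_le (min_le_left _ _))]
    simp only [hG] at hδ0; linarith
  · rintro y ⟨hy0, hy1, hy2⟩
    have hy3 : y < 1 := hy2.trans_le (min_le_left _ _)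
    have hδ3 : δ < 1 := hδ2.trans_le (min_le_left _ _)
    have e1 : profile √(y ^ 2 - ε ^ 2) / profile y = K α ε := by
      rw [g_eq_zero_iff hy3] at hy0
      rw [hy0, mul_div_cancel_right₀ _ (profile_pos hy3).ne']
    have e2 : profile √(δ ^ 2 - ε ^ 2) / profile δ = K α ε := by
      simp only [hG] at hδ0
      rw [div_eq_iff (profile_pos hδ3).ne']; linarith
    rcases lt_trichotomy y δ with h | h | h
    · have := profile_ratio_strictMono hε hy1 h hδ3
      linarith
    · exact h
    · have := profile_ratio_strictMono hε hδ1 h hy3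
      linarith

lemma IsDelta.candidateData {α ε δ : ℝ} (hα0 : 0 < α) (hε : 0 < ε)
    (hs : Subcritical α ε) (h : IsDelta α ε δ) : CandidateData α ε √(δ ^ 2 - ε ^ 2) δ := by
  obtain ⟨h0, h1, h2⟩ := h
  have hδ1 : δ < 1 := h2.trans_le (min_le_left _ _)
  have hδ0 : 0 < δ := hε.trans h1
  have hpos : 0 < δ ^ 2 - ε ^ 2 := by nlinarith
  refine ⟨hα0, hε, Real.sqrt_pos.2 hpos, hδ0, ?_, ?_⟩
  · rw [Real.sq_sqrt hpos.le]; ring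
  · intro β hαβ hβ1
    have hβ0 : 0 < β := hα0.trans_le hαβ
    rw [g_eq_zero_iff hδ1] at h0
    have hden : 0 < Real.exp (√α * ε) - α * Real.exp (ε / √α) := sub_pos.2 hs
    have hρ : profile δ = profile √(δ ^ 2 - ε ^ 2) *
        ((Real.exp (√α * ε) - α * Real.exp (ε / √α)) / (1 - α)) := by
      have : (1 - α) ≠ 0 := by linarith
      rw [h0, K]; field_simp
    have hpp : 0 < profile √(δ ^ 2 - ε ^ 2) := by
      apply profile_pos
      rw [Real.sqrt_lt' one_pos]
      nlinarith
    have hk := kappa_mono (Real.sqrt_pos.2 hα0) (Real.sqrt_le_sqrt hαβ)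
      ((Real.sqrt_lt' one_pos).2 (by simpa using hβ1)) hε
    rw [Real.sq_sqrt hα0.le, Real.sq_sqrt hβ0.le] at hk
    have h3 := mul_le_mul_of_nonneg_left hk hpp.le
    rw [← hρ, ← mul_div_assoc, le_div_iff₀ (by linarith)] at h3
    linarith

/-! ### The candidate on the strip -/

/-- The variance `x₂ - x₁²` of a point of the strip. -/
def var (x : ℝ × ℝ) : ℝ := x.2 - x.1 ^ 2

lemma mem_strip_iff {ε : ℝ} {x : ℝ × ℝ} : x ∈ strip ε ↔ 0 ≤ var x ∧ var x ≤ ε ^ 2 := by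
  simp only [strip, var, mem_ofPred_eq]
  constructor <;> rintro ⟨h1, h2⟩ <;> constructor <;> linarith

lemma Bfun_eq {δ : ℝ} (x : ℝ × ℝ) :
    Bfun δ x = (profile δ)⁻¹ * (Real.exp x.1 * profile √(δ ^ 2 - var x)) := by
  have : δ ^ 2 - var x = δ ^ 2 - x.2 + x.1 ^ 2 := by unfold var; ring
  rw [this, Bfun, profile, profile, mul_inv, Real.exp_add, Real.exp_neg]
  ring

/-- The `α`-concavity of the candidate: concavity across all splittings of a point of the strip
into two points of the strip with weights at least `α`. The chord itself may leave the strip. -/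
theorem CandidateData.concave {α ε ρ δ : ℝ} (h : CandidateData α ε ρ δ) (hδ : δ < 1)
    {β : ℝ} (hβ0 : α ≤ β) (hβ1 : β ≤ 1 - α) {x y : ℝ × ℝ} (hx : x ∈ strip ε) (hy : y ∈ strip ε)
    (hxy : β • x + (1 - β) • y ∈ strip ε) :
    β * Bfun δ x + (1 - β) * Bfun δ y ≤ Bfun δ (β • x + (1 - β) • y) := by
  have hρ := h.ρ_pos
  have hsq := h.sq_eq
  -- By symmetry, `x` may be taken to be the right endpoint.
  wlog hD : y.1 ≤ x.1 generalizing x y β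
  · have := this (β := 1 - β) (x := y) (y := x) (by linarith) (by linarith) hy hx
      (by rwa [sub_sub_cancel, add_comm]) (by linarith)
    rw [sub_sub_cancel, add_comm ((1 - β) • y)] at this
    linarith
  rw [mem_strip_iff] at hx hy hxy
  set z := β • x + (1 - β) • y with hz
  have hz1 : z.1 = β * x.1 + (1 - β) * y.1 := by simp [hz]
  have hz2 : z.2 = β * x.2 + (1 - β) * y.2 := by simp [hz]
  have hsqrt : ∀ w : ℝ × ℝ, 0 ≤ var w → var w ≤ ε ^ 2 → √(δ ^ 2 - var w) ^ 2 = δ ^ 2 - var w ∧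
      ρ ≤ √(δ ^ 2 - var w) ∧ √(δ ^ 2 - var w) ≤ δ := by
    intro w hw0 hw1
    refine ⟨Real.sq_sqrt (by nlinarith), ?_, ?_⟩
    · apply Real.le_sqrt_of_sq_le; linarith
    · rw [Real.sqrt_le_left h.δ_pos.le]; linarith
  obtain ⟨ex, hx1, hx2⟩ := hsqrt x hx.1 hx.2
  obtain ⟨ey, hy1, hy2⟩ := hsqrt y hy.1 hy.2
  obtain ⟨ez, hz1', hz2'⟩ := hsqrt z hxy.1 hxy.2
  have key := chord_le h hβ0 (by linarith [h.α_pos]) (sub_nonneg.2 hD) hx1 hy1 hy2 hz1' (by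
    rw [ex, ey, ez]
    simp only [var, hz1, hz2]
    ring)
  rw [Bfun_eq, Bfun_eq, Bfun_eq]
  have hC : 0 < (profile δ)⁻¹ * Real.exp y.1 := mul_pos (inv_pos.2 (profile_pos hδ)) (Real.exp_pos _)
  have e1 : Real.exp x.1 = Real.exp y.1 * Real.exp (x.1 - y.1) := by
    rw [← Real.exp_add]; ring_nf
  have e2 : Real.exp z.1 = Real.exp y.1 * Real.exp (β * (x.1 - y.1)) := by
    rw [← Real.exp_add, hz1]; ring_nf
  rw [e1, e2]
  have := mul_le_mul_of_nonneg_left key hC.le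
  calc _ = _ := by ring
    _ ≤ _ := this
    _ = _ := by ring

/-! ### Dyadic cubes -/

section Cubes

variable {n : ℕ}

lemma isOpen_cube (m : ℤ) (k : Fin n → ℤ) : IsOpen (cube n m k) :=
  isOpen_set_pi Set.finite_univ fun _ _ => isOpen_Ioo

lemma measurableSet_cube (m : ℤ) (k : Fin n → ℤ) : MeasurableSet (cube n m k) :=
  (isOpen_cube m k).measurableSet

lemma volume_cube (m : ℤ) (k : Fin n → ℤ) :
    volume (cube n m k) = ENNReal.ofReal (((2 : ℝ) ^ (-m)) ^ n) := by
  rw [cube, volume_pi_pi]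
  simp only [Real.volume_Ioo]
  have : ∀ i, ((k i : ℝ) + 1) * (2 : ℝ) ^ (-m) - (k i : ℝ) * (2 : ℝ) ^ (-m) = (2 : ℝ) ^ (-m) :=
    fun i => by ring
  simp only [this, Finset.prod_const, Finset.card_univ, Fintype.card_fin]
  rw [ENNReal.ofReal_pow (by positivity)]

lemma volume_cube_ne_zero (m : ℤ) (k : Fin n → ℤ) : volume (cube n m k) ≠ 0 := by
  rw [volume_cube]; simp only [ne_eq, ENNReal.ofReal_eq_zero, not_le]; positivity

lemma volume_cube_ne_top (m : ℤ) (k : Fin n → ℤ) : volume (cube n m k) ≠ ⊤ := by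
  rw [volume_cube]; exact ENNReal.ofReal_ne_top

/-- The index of the dyadic child of the cube with index `k` in the position `σ`. -/
def child (k : Fin n → ℤ) (σ : Fin n → Fin 2) : Fin n → ℤ := fun i => 2 * k i + ((σ i : ℕ) : ℤ)

lemma two_zpow_neg_succ (m : ℤ) : (2 : ℝ) ^ (-m) = 2 * (2 : ℝ) ^ (-(m + 1)) := by
  rw [neg_add, zpow_add₀ (by norm_num)]; norm_num; ring

lemma volume_child (m : ℤ) (k : Fin n → ℤ) (σ : Fin n → Fin 2) :
    volume (cube n m k) = 2 ^ n * volume (cube n (m + 1) (child k σ)) := by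
  rw [volume_cube, volume_cube, two_zpow_neg_succ, mul_pow, ENNReal.ofReal_mul (by positivity),
    ENNReal.ofReal_pow (by norm_num)]
  simp

/-- Two dyadic cubes that meet are nested. -/
lemma cube_subset_of_inter {m : ℤ} {p : ℕ} {k k' : Fin n → ℤ}
    (h : (cube n m k ∩ cube n (m + p) k').Nonempty) : cube n (m + p) k' ⊆ cube n m k := by
  obtain ⟨x, hx1, hx2⟩ := h
  intro y hy i hi
  have h1 := hx1 i hi
  have h2 := hx2 i hi
  have h3 := hy i hi
  simp only [mem_Ioo] at h1 h2 h3 ⊢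
  set s := (2 : ℝ) ^ (-(m + p)) with hs
  have hs0 : 0 < s := by positivity
  have e : (2 : ℝ) ^ (-m) = 2 ^ p * s := by
    rw [hs, neg_add, zpow_add₀ (by norm_num), mul_left_comm, ← zpow_natCast,
      ← zpow_add₀ (by norm_num)]
    simp
  rw [e, ← mul_assoc] at h1 ⊢
  rw [← mul_assoc] at h1 ⊢
  have h4 : (k i : ℝ) * 2 ^ p < k' i + 1 := lt_of_mul_lt_mul_right (h1.1.trans h2.2) hs0.le
  have h5 : (k' i : ℝ) < (k i + 1) * 2 ^ p := lt_of_mul_lt_mul_right (h2.1.trans h1.2) hs0.le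
  have h4' : k i * 2 ^ p < k' i + 1 := by exact_mod_cast h4
  have h5' : k' i < (k i + 1) * 2 ^ p := by exact_mod_cast h5
  have h6 : (k i : ℝ) * 2 ^ p ≤ k' i := by exact_mod_cast Int.lt_add_one_iff.1 h4'
  have h7 : (k' i : ℝ) + 1 ≤ (k i + 1) * 2 ^ p := by exact_mod_cast Int.add_one_le_iff.2 h5'
  exact ⟨(mul_le_mul_of_nonneg_right h6 hs0.le).trans_lt h3.1,
    h3.2.trans_le (mul_le_mul_of_nonneg_right h7 hs0.le)⟩

lemma cube_subset_of_le {m m' : ℤ} {k k' : Fin n → ℤ} (hm : m ≤ m')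
    (h : (cube n m k ∩ cube n m' k').Nonempty) : cube n m' k' ⊆ cube n m k := by
  obtain ⟨p, rfl⟩ := Int.le.dest hm
  exact cube_subset_of_inter h

lemma cube_nonempty (m : ℤ) (k : Fin n → ℤ) : (cube n m k).Nonempty :=
  nonempty_of_measure_ne_zero (volume_cube_ne_zero m k)

lemma child_subset (m : ℤ) (k : Fin n → ℤ) (σ : Fin n → Fin 2) :
    cube n (m + 1) (child k σ) ⊆ cube n m k := by
  intro x hx i hi
  have h := hx i hi
  have e := two_zpow_neg_succ m
  have hs0 : (0 : ℝ) < (2 : ℝ) ^ (-(m + 1)) := by positivity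
  have h1 : ((σ i : ℕ) : ℝ) ≤ 1 := by exact_mod_cast Nat.lt_succ_iff.1 (σ i).2
  have h0 : (0 : ℝ) ≤ ((σ i : ℕ) : ℝ) := by positivity
  simp only [mem_Ioo, child] at h ⊢
  push_cast at h
  rw [e]
  constructor <;> nlinarith

lemma child_disjoint (m : ℤ) (k : Fin n → ℤ) {σ τ : Fin n → Fin 2} (h : σ ≠ τ) :
    Disjoint (cube n (m + 1) (child k σ)) (cube n (m + 1) (child k τ)) := by
  rw [Set.disjoint_left]
  intro x hx hy
  apply h
  funext i
  have h1 := hx i (mem_univ i)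
  have h2 := hy i (mem_univ i)
  have hs0 : (0 : ℝ) < (2 : ℝ) ^ (-(m + 1)) := by positivity
  simp only [mem_Ioo, child] at h1 h2
  have h3 := lt_of_mul_lt_mul_right (h1.1.trans h2.2) hs0.le
  have h4 := lt_of_mul_lt_mul_right (h2.1.trans h1.2) hs0.le
  push_cast at h3 h4
  have h5 : (σ i : ℕ) < (τ i : ℕ) + 1 := by
    have : ((σ i : ℕ) : ℝ) < (τ i : ℕ) + 1 := by linarith
    exact_mod_cast this
  have h6 : (τ i : ℕ) < (σ i : ℕ) + 1 := by
    have : ((τ i : ℕ) : ℝ) < (σ i : ℕ) + 1 := by linarith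
    exact_mod_cast this
  exact Fin.ext (by omega)

/-- Up to a null set, a dyadic cube is the union of its children. -/
lemma iUnion_child_ae_eq (m : ℤ) (k : Fin n → ℤ) :
    (⋃ σ, cube n (m + 1) (child k σ)) =ᵐ[volume] cube n m k := by
  apply ae_eq_of_subset_of_measure_ge
  · exact iUnion_subset fun σ => child_subset m k σ
  · rw [measure_iUnion (fun σ τ h => child_disjoint m k h) fun σ => measurableSet_cube _ _,
      tsum_fintype]
    have : ∀ σ τ : Fin n → Fin 2, volume (cube n (m + 1) (child k σ)) =
        volume (cube n (m + 1) (child k τ)) := fun σ τ => by rw [volume_cube, volume_cube]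
    rw [Finset.sum_congr rfl fun σ _ => this σ 0]
    simp only [Finset.sum_const, Finset.card_univ, Fintype.card_fun, Fintype.card_fin, nsmul_eq_mul]
    rw [volume_child m k 0]
    simp
  · exact (MeasurableSet.iUnion fun σ => measurableSet_cube _ _).nullMeasurableSet
  · exact volume_cube_ne_top m k

/-- A dyadic subcube of a dyadic cube is the cube itself or lies in one of its children. -/
lemma eq_or_subset_child {m : ℤ} {k : Fin n → ℤ} {J : Set (Fin n → ℝ)}
    (hJ : J ∈ dyadicSubcubes n (cube n m k)) :
    J = cube n m k ∨ ∃ σ, J ⊆ cube n (m + 1) (child k σ) := by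
  obtain ⟨⟨m', k', rfl⟩, hsub⟩ := hJ
  rcases le_or_gt m' m with h | h
  · left
    refine subset_antisymm hsub (cube_subset_of_le h ?_)
    rw [inter_eq_self_of_subset_left hsub]
    exact cube_nonempty _ _
  · right
    have hae := iUnion_child_ae_eq m k
    by_contra hc
    push Not at hc
    have hdis : ∀ σ, cube n (m + 1) (child k σ) ∩ cube n m' k' = ∅ := by
      intro σ
      by_contra hne
      exact hc σ (cube_subset_of_le (by omega) (nonempty_iff_ne_empty.2 hne))
    have h0 : volume ((⋃ σ, cube n (m + 1) (child k σ)) ∩ cube n m' k') = 0 := by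
      rw [iUnion_inter]; simp [hdis]
    have h1 : ((⋃ σ, cube n (m + 1) (child k σ)) ∩ cube n m' k' : Set _) =ᵐ[volume]
        (cube n m k ∩ cube n m' k' : Set _) := hae.inter (ae_eq_refl _)
    rw [measure_congr h1, inter_eq_self_of_subset_right hsub] at h0
    exact volume_cube_ne_zero m' k' h0

lemma child_mem_dyadicCubes (m : ℤ) (k : Fin n → ℤ) (σ : Fin n → Fin 2) :
    cube n (m + 1) (child k σ) ∈ dyadicCubes n := ⟨_, _, rfl⟩

/-! ### Averages over dyadic cubes -/

lemma setAverage_cube_eq_sum {m : ℤ} {k : Fin n → ℤ} {f : (Fin n → ℝ) → ℝ}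
    (hf : IntegrableOn f (cube n m k)) :
    ⨍ t in cube n m k, f t = ((2 : ℝ) ^ n)⁻¹ * ∑ σ, ⨍ t in cube n (m + 1) (child k σ), f t := by
  have h1 : ∫ t in cube n m k, f t = ∑ σ, ∫ t in cube n (m + 1) (child k σ), f t := by
    rw [← setIntegral_congr_set (iUnion_child_ae_eq m k),
      integral_iUnion_fintype (fun σ => measurableSet_cube _ _)
      (fun σ τ h => child_disjoint m k h) (fun σ => hf.mono_set (child_subset m k σ))]
  rw [setAverage_eq, h1, Finset.smul_sum, Finset.mul_sum]
  refine Finset.sum_congr rfl fun σ _ => ?_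
  rw [setAverage_eq, measureReal_def, measureReal_def, volume_child m k σ, ENNReal.toReal_mul]
  simp only [smul_eq_mul, ENNReal.toReal_pow, ENNReal.toReal_ofNat, mul_inv]
  ring

lemma setLAverage_cube_eq_sum {m : ℤ} {k : Fin n → ℤ} (f : (Fin n → ℝ) → ℝ≥0∞) :
    ⨍⁻ t in cube n m k, f t ∂volume =
      ((2 : ℝ≥0∞) ^ n)⁻¹ * ∑ σ, ⨍⁻ t in cube n (m + 1) (child k σ), f t ∂volume := by
  have h1 : ∫⁻ t in cube n m k, f t = ∑ σ, ∫⁻ t in cube n (m + 1) (child k σ), f t := by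
    rw [← setLIntegral_congr (iUnion_child_ae_eq m k),
      lintegral_iUnion (fun σ => measurableSet_cube _ _) (fun σ τ h => child_disjoint m k h),
      tsum_fintype]
  rw [setLAverage_eq, h1, div_eq_mul_inv, Finset.sum_mul, Finset.mul_sum]
  refine Finset.sum_congr rfl fun σ _ => ?_
  rw [setLAverage_eq, volume_child m k σ, ENNReal.mul_inv (by simp) (by simp), div_eq_mul_inv]
  ring

lemma integrableOn_cube_of_child {m : ℤ} {k : Fin n → ℤ} {f : (Fin n → ℝ) → ℝ}
    (hf : ∀ σ, IntegrableOn f (cube n (m + 1) (child k σ))) : IntegrableOn f (cube n m k) :=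
  ((integrableOn_finite_iUnion).2 hf).congr_set_ae (iUnion_child_ae_eq m k).symm

/-- The averages of `φ` and of `φ²` over `J`, a point of the Bellman domain. -/
def moments (J : Set (Fin n → ℝ)) (φ : (Fin n → ℝ) → ℝ) : ℝ × ℝ :=
  (⨍ t in J, φ t, ⨍ t in J, φ t ^ 2)

lemma setAverage_const_cube {J : Set (Fin n → ℝ)} (hJ : J ∈ dyadicCubes n) (c : ℝ) :
    ⨍ _ in J, c = c := by
  obtain ⟨m, k, rfl⟩ := hJ
  exact setAverage_const (volume_cube_ne_zero m k) (volume_cube_ne_top m k) c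

lemma average_sub_sq {J : Set (Fin n → ℝ)} (hJ : J ∈ dyadicCubes n) {φ : (Fin n → ℝ) → ℝ}
    (h1 : IntegrableOn φ J) (h2 : IntegrableOn (fun t => φ t ^ 2) J) (c : ℝ) :
    IntegrableOn (fun t => (φ t - c) ^ 2) J ∧
    ⨍ t in J, (φ t - c) ^ 2 = (⨍ t in J, φ t ^ 2) - 2 * c * (⨍ t in J, φ t) + c ^ 2 := by
  have hc := setAverage_const_cube hJ (c ^ 2)
  have hci : IntegrableOn (fun _ => c ^ 2) J volume := by
    obtain ⟨m, k, rfl⟩ := hJ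
    exact integrableOn_const (volume_cube_ne_top m k)
  have e : (fun t => (φ t - c) ^ 2) = fun t => φ t ^ 2 - 2 * c * φ t + c ^ 2 := by
    funext t; ring
  rw [e]
  refine ⟨(h2.sub (h1.const_mul _)).add hci, ?_⟩
  simp only [setAverage_eq, smul_eq_mul] at hc ⊢
  have hs : Integrable (fun t => φ t ^ 2 - 2 * c * φ t) (volume.restrict J) :=
    Integrable.sub h2 (h1.const_mul _)
  rw [integral_add hs hci, integral_sub h2 (h1.const_mul _), integral_const_mul, mul_add, hc]
  ring

lemma setLAverage_ofReal {J : Set (Fin n → ℝ)} (hJ : J ∈ dyadicCubes n) {f : (Fin n → ℝ) → ℝ}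
    (hf : IntegrableOn f J) (h0 : ∀ t, 0 ≤ f t) :
    ⨍⁻ t in J, ENNReal.ofReal (f t) ∂volume = ENNReal.ofReal (⨍ t in J, f t) := by
  obtain ⟨m, k, rfl⟩ := hJ
  have hp : 0 < volume.real (cube n m k) :=
    ENNReal.toReal_pos (volume_cube_ne_zero m k) (volume_cube_ne_top m k)
  rw [setLAverage_eq, setAverage_eq, ← ofReal_integral_eq_lintegral_ofReal hf (ae_of_all _ h0),
    smul_eq_mul, inv_mul_eq_div, ENNReal.ofReal_div_of_pos hp, measureReal_def,
    ENNReal.ofReal_toReal (volume_cube_ne_top m k)]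

lemma oscillation_eq {J : Set (Fin n → ℝ)} (hJ : J ∈ dyadicCubes n) {φ : (Fin n → ℝ) → ℝ}
    (h1 : IntegrableOn φ J) (h2 : IntegrableOn (fun t => φ t ^ 2) J) :
    oscillation J φ = ENNReal.ofReal (var (moments J φ)) := by
  have h := average_sub_sq hJ h1 h2 (⨍ t in J, φ t)
  unfold oscillation
  simp only [sq_abs]
  rw [setLAverage_ofReal hJ h.1 (fun t => sq_nonneg _), h.2]
  congr 1
  simp only [var, moments]
  ring

lemma var_moments_nonneg {J : Set (Fin n → ℝ)} (hJ : J ∈ dyadicCubes n) {φ : (Fin n → ℝ) → ℝ}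
    (h1 : IntegrableOn φ J) (h2 : IntegrableOn (fun t => φ t ^ 2) J) :
    0 ≤ var (moments J φ) := by
  have h := average_sub_sq hJ h1 h2 (⨍ t in J, φ t)
  have h3 : 0 ≤ ⨍ t in J, (φ t - ⨍ t in J, φ t) ^ 2 := by
    rw [setAverage_eq]
    exact smul_nonneg (by positivity) (integral_nonneg fun t => sq_nonneg _)
  rw [h.2] at h3
  simp only [var, moments]
  linarith

lemma bmoNorm_le_iff {S : Set (Set (Fin n → ℝ))} {φ : (Fin n → ℝ) → ℝ} {ε : ℝ} (hε : 0 ≤ ε) :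
    bmoNorm S φ ≤ ENNReal.ofReal ε ↔ ∀ J ∈ S, oscillation J φ ≤ ENNReal.ofReal (ε ^ 2) := by
  unfold bmoNorm
  rw [iSup₂_le_iff]
  refine forall₂_congr fun J _ => ?_
  rw [ENNReal.ofReal_pow hε, ← ENNReal.rpow_natCast, one_div,
    ENNReal.rpow_inv_le_iff (by norm_num)]
  norm_num

lemma integrableOn_sq_of_oscillation {J : Set (Fin n → ℝ)} (hJ : J ∈ dyadicCubes n)
    {φ : (Fin n → ℝ) → ℝ} (h1 : IntegrableOn φ J) (h2 : oscillation J φ ≠ ⊤) :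
    IntegrableOn (fun t => φ t ^ 2) J := by
  set c := ⨍ t in J, φ t with hc
  have hci : IntegrableOn (fun _ => c ^ 2) J volume := by
    obtain ⟨m, k, rfl⟩ := hJ
    exact integrableOn_const (volume_cube_ne_top m k)
  have h3 : IntegrableOn (fun t => (φ t - c) ^ 2) J := by
    have hm : AEStronglyMeasurable (fun t => (φ t - c) ^ 2) (volume.restrict J) := by
      have := h1.1.sub (aestronglyMeasurable_const (b := c))
      exact this.pow 2
    refine ⟨hm, ?_⟩
    rw [hasFiniteIntegral_iff_ofReal (ae_of_all _ fun t => sq_nonneg _)]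
    unfold oscillation at h2
    simp only [sq_abs, setLAverage_eq] at h2
    rw [lt_top_iff_ne_top]
    intro htop
    apply h2
    obtain ⟨m, k, rfl⟩ := hJ
    rw [← hc, htop, ENNReal.top_div_of_ne_top (volume_cube_ne_top m k)]
  have e : (fun t => φ t ^ 2) = fun t => (φ t - c) ^ 2 + 2 * c * φ t - c ^ 2 := by
    funext t; ring
  rw [e]
  exact (h3.add (h1.const_mul _)).sub hci

/-- Membership in the `BMO` ball on a dyadic cube in terms of the moments over subcubes. -/
lemma mem_bmoBallOn_iff {Q : Set (Fin n → ℝ)} (hQ : Q ∈ dyadicCubes n) {ε : ℝ} (hε : 0 ≤ ε)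
    {φ : (Fin n → ℝ) → ℝ} :
    φ ∈ bmoBallOn n Q ε ↔ IntegrableOn φ Q ∧ IntegrableOn (fun t => φ t ^ 2) Q ∧
      ∀ J ∈ dyadicSubcubes n Q, var (moments J φ) ≤ ε ^ 2 := by
  simp only [bmoBallOn, mem_ofPred_eq, bmoNorm_le_iff hε]
  constructor
  · rintro ⟨h1, h2⟩
    have h3 := integrableOn_sq_of_oscillation hQ h1
      (ne_top_of_le_ne_top ENNReal.ofReal_ne_top (h2 Q ⟨hQ, subset_rfl⟩))
    refine ⟨h1, h3, fun J hJ => ?_⟩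
    have := h2 J hJ
    rw [oscillation_eq hJ.1 (h1.mono_set hJ.2) (h3.mono_set hJ.2)] at this
    exact (ENNReal.ofReal_le_ofReal_iff (sq_nonneg ε)).1 this
  · rintro ⟨h1, h3, h2⟩
    refine ⟨h1, fun J hJ => ?_⟩
    rw [oscillation_eq hJ.1 (h1.mono_set hJ.2) (h3.mono_set hJ.2)]
    exact ENNReal.ofReal_le_ofReal (h2 J hJ)

lemma bmoBallOn_mono_set {Q R : Set (Fin n → ℝ)} (hRQ : R ⊆ Q) {ε : ℝ}
    {φ : (Fin n → ℝ) → ℝ} (h : φ ∈ bmoBallOn n Q ε) : φ ∈ bmoBallOn n R ε := by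
  refine ⟨h.1.mono_set hRQ, le_trans ?_ h.2⟩
  exact iSup₂_mono' fun J hJ => ⟨J, ⟨hJ.1, hJ.2.trans hRQ⟩, le_rfl⟩

lemma moments_mem_strip {Q : Set (Fin n → ℝ)} (hQ : Q ∈ dyadicCubes n) {ε : ℝ} (hε : 0 ≤ ε)
    {φ : (Fin n → ℝ) → ℝ} (h : φ ∈ bmoBallOn n Q ε) : moments Q φ ∈ strip ε := by
  rw [mem_bmoBallOn_iff hQ hε] at h
  exact mem_strip_iff.2 ⟨var_moments_nonneg hQ h.1 h.2.1, h.2.2 Q ⟨hQ, subset_rfl⟩⟩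

end Cubes

/-! ### The upper bound -/

/-- The candidate is concave across splittings into up to `1 / α` pieces of equal weight: one can
always split off a single piece so that the variance of the rest does not exceed that of the
whole. -/
theorem CandidateData.sum_le {α ε ρ δ : ℝ} (h : CandidateData α ε ρ δ) (hδ : δ < 1)
    {ι : Type*} [DecidableEq ι] (x : ι → ℝ × ℝ) (k : ℕ) :
    ∀ s : Finset ι, s.card = k + 1 → α * (k + 1) ≤ 1 → (∀ i ∈ s, x i ∈ strip ε) →
      ((k : ℝ) + 1)⁻¹ • ∑ i ∈ s, x i ∈ strip ε →
      ((k : ℝ) + 1)⁻¹ * ∑ i ∈ s, Bfun δ (x i) ≤ Bfun δ (((k : ℝ) + 1)⁻¹ • ∑ i ∈ s, x i) := by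
  induction k with
  | zero =>
    intro s hs _ _ _
    obtain ⟨a, rfl⟩ := Finset.card_eq_one.1 (by simpa using hs)
    simp
  | succ k ih =>
    intro s hs hα hmem havg
    have hk : (0 : ℝ) < (k : ℝ) + 1 := by positivity
    have hk2 : (0 : ℝ) < (k : ℝ) + 1 + 1 := by positivity
    push_cast at hα havg ⊢
    set S := ∑ i ∈ s, x i with hS
    have hS1 : S.1 = ∑ i ∈ s, (x i).1 := by simp [hS, Prod.fst_sum]
    have hS2 : S.2 = ∑ i ∈ s, (x i).2 := by simp [hS, Prod.snd_sum]
    obtain ⟨j, hj, hjle⟩ : ∃ j ∈ s, var (((k : ℝ) + 1)⁻¹ • (S - x j)) ≤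
        var (((k : ℝ) + 1 + 1)⁻¹ • S) := by
      apply Finset.exists_le_of_sum_le (by rw [← Finset.card_pos]; omega)
      have hcs := sq_sum_le_card_mul_sum_sq (s := s) (f := fun i => (x i).1)
      rw [hs, ← hS1] at hcs
      push_cast at hcs
      have e : ∀ j, var (((k : ℝ) + 1)⁻¹ • (S - x j)) =
          ((k : ℝ) + 1)⁻¹ * S.2 - ((k : ℝ) + 1)⁻¹ * (x j).2 - (((k : ℝ) + 1)⁻¹) ^ 2 * S.1 ^ 2 +
          2 * (((k : ℝ) + 1)⁻¹) ^ 2 * S.1 * (x j).1 - (((k : ℝ) + 1)⁻¹) ^ 2 * (x j).1 ^ 2 := by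
        intro j
        simp only [var, Prod.smul_fst, Prod.smul_snd, Prod.fst_sub, Prod.snd_sub, smul_eq_mul]
        ring
      simp only [e, Finset.sum_sub_distrib, Finset.sum_add_distrib, ← Finset.mul_sum,
        Finset.sum_const, hs, ← hS1, ← hS2, nsmul_eq_mul]
      simp only [var, Prod.smul_fst, Prod.smul_snd, smul_eq_mul]
      push_cast
      set q := ∑ i ∈ s, (x i).1 ^ 2
      have h1 : ((k : ℝ) + 1 + 1)⁻¹ * S.1 ^ 2 ≤ q := by
        rw [inv_mul_le_iff₀ hk2]; exact hcs
      have h2 := mul_le_mul_of_nonneg_left h1 (sq_nonneg ((k : ℝ) + 1)⁻¹)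
      have e3 : (((k : ℝ) + 1)⁻¹) ^ 2 * (((k : ℝ) + 1 + 1)⁻¹ * S.1 ^ 2) =
        ((k : ℝ) + 1 + 1) * (((k : ℝ) + 1 + 1)⁻¹ * S.1) ^ 2 -
          (((k : ℝ) + 1 + 1) * ((((k : ℝ) + 1)⁻¹) ^ 2 * S.1 ^ 2) -
            2 * (((k : ℝ) + 1)⁻¹) ^ 2 * S.1 * S.1) := by
        field_simp
        ring
      have e5 : ((k : ℝ) + 1 + 1) * (((k : ℝ) + 1)⁻¹ * S.2) - ((k : ℝ) + 1)⁻¹ * S.2 =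
          ((k : ℝ) + 1 + 1) * (((k : ℝ) + 1 + 1)⁻¹ * S.2) := by
        field_simp; ring
      linarith
    set y := ((k : ℝ) + 1)⁻¹ • (S - x j) with hy
    have hcard : (s.erase j).card = k + 1 := by rw [Finset.card_erase_of_mem hj, hs]; rfl
    have hsum : ∑ i ∈ s.erase j, x i = S - x j := by
      rw [hS, ← Finset.add_sum_erase s x hj, add_sub_cancel_left]
    have hy0 : 0 ≤ var y := by
      have hcs := sq_sum_le_card_mul_sum_sq (s := s.erase j) (f := fun i => (x i).1)
      have h2 : ∑ i ∈ s.erase j, (x i).1 ^ 2 ≤ ∑ i ∈ s.erase j, (x i).2 :=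
        Finset.sum_le_sum fun i hi => (hmem i (Finset.mem_of_mem_erase hi)).1
      have e1 : (S - x j).1 = ∑ i ∈ s.erase j, (x i).1 := by rw [← hsum]; simp [Prod.fst_sum]
      have e2 : (S - x j).2 = ∑ i ∈ s.erase j, (x i).2 := by rw [← hsum]; simp [Prod.snd_sum]
      rw [hcard, ← e1] at hcs
      rw [← e2] at h2
      push_cast at hcs
      have h3 := hcs.trans (mul_le_mul_of_nonneg_left h2 hk.le)
      simp only [hy, var, Prod.smul_fst, Prod.smul_snd, smul_eq_mul]
      have : ((k : ℝ) + 1)⁻¹ * (S - x j).2 - (((k : ℝ) + 1)⁻¹ * (S - x j).1) ^ 2 =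
        (((k : ℝ) + 1)⁻¹) ^ 2 * (((k : ℝ) + 1) * (S - x j).2 - (S - x j).1 ^ 2) := by
        field_simp
      rw [this]
      exact mul_nonneg (sq_nonneg _) (by linarith)
    have hyΩ : y ∈ strip ε := mem_strip_iff.2 ⟨hy0, hjle.trans (mem_strip_iff.1 havg).2⟩
    have h1 := ih (s.erase j) hcard (by nlinarith [h.α_pos])
      (fun i hi => hmem i (Finset.mem_of_mem_erase hi)) (by rw [hsum]; exact hyΩ)
    rw [hsum] at h1
    set β := ((k : ℝ) + 1 + 1)⁻¹ with hβ
    have hβ1 : 1 - β = ((k : ℝ) + 1) * β := by rw [hβ]; field_simp; ring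
    have e : β • x j + (1 - β) • y = β • S := by
      have e0 : ((k : ℝ) + 1) * β * ((k : ℝ) + 1)⁻¹ = β := by field_simp
      rw [hβ1, hy, smul_smul, e0, ← smul_add, add_sub_cancel]
    have hαβ : α ≤ β := by rw [hβ, le_inv_comm₀ h.α_pos hk2, ← one_div, le_div_iff₀ h.α_pos]; linarith
    have hβ2 : β ≤ 1 / 2 := by
      rw [hβ, inv_le_comm₀ hk2 (by norm_num)]
      have : (0 : ℝ) ≤ k := by positivity
      norm_num; linarith
    have h2 := h.concave hδ hαβ (by linarith) (hmem j hj) hyΩ (by rw [e]; exact havg)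
    rw [e] at h2
    refine le_trans (le_of_eq ?_) ((add_le_add le_rfl (mul_le_mul_of_nonneg_left h1
      (by linarith : 0 ≤ 1 - β))).trans h2)
    rw [← Finset.add_sum_erase s _ hj, hβ1]
    field_simp

lemma CandidateData.exp_le_Bfun {α ε ρ δ : ℝ} (h : CandidateData α ε ρ δ) (hδ : δ < 1)
    {x : ℝ × ℝ} (hx : x ∈ strip ε) : Real.exp x.1 ≤ Bfun δ x := by
  rw [mem_strip_iff] at hx
  rw [Bfun_eq]
  have hp := profile_pos hδ
  have h1 : profile δ ≤ profile √(δ ^ 2 - var x) :=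
    profile_anti (Real.sqrt_nonneg _) (by rw [Real.sqrt_le_left h.δ_pos.le]; linarith)
  rw [← mul_assoc, mul_comm (profile δ)⁻¹, mul_assoc]
  apply le_mul_of_one_le_right (Real.exp_pos _).le
  rwa [inv_mul_eq_div, one_le_div hp]

section Level

variable {n : ℕ}

/-- The index of the dyadic cube of side `2⁻ᵐ` that contains `t`. -/
def cubeIndex (m : ℤ) (t : Fin n → ℝ) : Fin n → ℤ := fun i => ⌊t i * (2 : ℝ) ^ m⌋

/-- The conditional expectation of `φ` with respect to the dyadic cubes of side `2⁻ᵐ`. -/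
def levelAverage (φ : (Fin n → ℝ) → ℝ) (m : ℤ) (t : Fin n → ℝ) : ℝ :=
  ⨍ s in cube n m (cubeIndex m t), φ s

lemma cubeIndex_eq {m : ℤ} {k : Fin n → ℤ} {t : Fin n → ℝ} (ht : t ∈ cube n m k) :
    cubeIndex m t = k := by
  funext i
  have h := ht i (mem_univ i)
  have hp : (0 : ℝ) < (2 : ℝ) ^ m := by positivity
  rw [mem_Ioo, zpow_neg, ← div_eq_mul_inv, ← div_eq_mul_inv, div_lt_iff₀ hp, lt_div_iff₀ hp] at h
  exact Int.floor_eq_iff.2 ⟨h.1.le, h.2⟩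

lemma measurable_levelAverage (φ : (Fin n → ℝ) → ℝ) (m : ℤ) :
    Measurable (levelAverage φ m) := by
  have h1 : Measurable (cubeIndex (n := n) m) :=
    measurable_pi_iff.2 fun i => ((measurable_pi_apply i).mul_const _).floor
  exact (Measurable.of_discrete (f := fun k => ⨍ s in cube n m k, φ s)).comp h1

/-- The centre of a dyadic cube. -/
def cubeCenter (m : ℤ) (k : Fin n → ℤ) : Fin n → ℝ := fun i => (k i + 1 / 2) * (2 : ℝ) ^ (-m)

lemma cube_eq_ball (m : ℤ) (k : Fin n → ℤ) :
    cube n m k = Metric.ball (cubeCenter m k) ((2 : ℝ) ^ (-m) / 2) := by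
  rw [ball_pi _ (by positivity), cube]
  congr 1
  funext i
  rw [Real.ball_eq_Ioo, cubeCenter]
  congr 1 <;> ring

lemma mem_closedBall_cubeCenter (m : ℤ) (t : Fin n → ℝ) :
    t ∈ Metric.closedBall (cubeCenter m (cubeIndex m t)) ((2 : ℝ) ^ (-m) / 2) := by
  rw [closedBall_pi _ (by positivity)]
  intro i _
  change t i ∈ Metric.closedBall _ _
  rw [Real.closedBall_eq_Icc, cubeCenter, cubeIndex]
  have hp : (0 : ℝ) < (2 : ℝ) ^ m := by positivity
  have h1 := Int.floor_le (t i * (2 : ℝ) ^ m)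
  have h2 := (Int.lt_floor_add_one (t i * (2 : ℝ) ^ m)).le
  have h3 : (⌊t i * (2 : ℝ) ^ m⌋ : ℝ) * (2 : ℝ) ^ (-m) ≤ t i := by
    rw [zpow_neg, ← div_eq_mul_inv, div_le_iff₀ hp]; exact h1
  have h4 : t i ≤ (⌊t i * (2 : ℝ) ^ m⌋ + 1 : ℝ) * (2 : ℝ) ^ (-m) := by
    rw [zpow_neg, ← div_eq_mul_inv, le_div_iff₀ hp]; exact h2
  constructor <;> linarith

lemma ae_tendsto_levelAverage {l : ℤ} {k : Fin n → ℤ} {φ : (Fin n → ℝ) → ℝ}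
    (hφ : IntegrableOn φ (cube n l k)) : ∀ᵐ t ∂volume.restrict (cube n l k),
      Filter.Tendsto (fun p : ℕ => levelAverage φ (l + p) t) Filter.atTop (nhds (φ t)) := by
  set f := (cube n l k).indicator φ with hf
  have hfi : Integrable f := hφ.integrable_indicator (measurableSet_cube l k)
  have h := IsUnifLocDoublingMeasure.ae_tendsto_average volume hfi.locallyIntegrable 1
  rw [ae_restrict_iff' (measurableSet_cube l k)]
  filter_upwards [h] with t ht htQ
  have hlim : Filter.Tendsto (fun p : ℕ => (2 : ℝ) ^ (-(l + p : ℤ)) / 2) Filter.atTop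
      (nhdsWithin 0 (Ioi 0)) := by
    rw [tendsto_nhdsWithin_iff]
    refine ⟨?_, Filter.Eventually.of_forall fun p => by simp only [mem_Ioi]; positivity⟩
    have h1 := (tendsto_pow_atTop_nhds_zero_of_lt_one (r := (1 / 2 : ℝ)) (by norm_num)
      (by norm_num)).const_mul ((2 : ℝ) ^ (-l) / 2)
    rw [mul_zero] at h1
    refine h1.congr fun p => ?_
    rw [neg_add, zpow_add₀ (by norm_num), zpow_neg _ (p : ℤ), zpow_natCast, one_div, inv_pow]
    ring
  have h2 := ht (fun p : ℕ => cubeCenter (l + p) (cubeIndex (l + p) t)) _ hlim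
    (Filter.Eventually.of_forall fun p => by rw [one_mul]; exact mem_closedBall_cubeCenter _ _)
  have h3 : f t = φ t := indicator_of_mem htQ φ
  rw [h3] at h2
  refine h2.congr fun p => ?_
  have hr : (2 : ℝ) ^ (-(l + p : ℤ)) / 2 ≠ 0 := by positivity
  have hsub : cube n (l + p) (cubeIndex (l + p) t) ⊆ cube n l k := by
    apply cube_subset_of_inter
    have h4 := mem_closedBall_cubeCenter (l + p) t
    rw [← closure_ball _ hr, ← cube_eq_ball, mem_closure_iff] at h4
    exact h4 _ (isOpen_cube l k) htQ
  have hae : (Metric.closedBall (cubeCenter (l + p) (cubeIndex (l + p) t))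
      ((2 : ℝ) ^ (-(l + p : ℤ)) / 2) : Set _) =ᵐ[volume] cube n (l + p) (cubeIndex (l + p) t) := by
    rw [cube_eq_ball]
    refine (ae_eq_of_subset_of_measure_ge Metric.ball_subset_closedBall ?_
      measurableSet_ball.nullMeasurableSet measure_closedBall_lt_top.ne).symm
    rw [Measure.addHaar_ball_of_pos _ _ (by positivity),
      Measure.addHaar_closedBall _ _ (by positivity)]
  rw [setAverage_congr hae, levelAverage, setAverage_eq, setAverage_eq]
  congr 1
  exact setIntegral_congr_fun (measurableSet_cube _ _) fun s hs => indicator_of_mem (hsub hs) φ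

lemma moments_cube_eq_sum {ε : ℝ} (hε : 0 ≤ ε) {l : ℤ} {k : Fin n → ℤ} {φ : (Fin n → ℝ) → ℝ}
    (hφ : φ ∈ bmoBallOn n (cube n l k) ε) :
    moments (cube n l k) φ =
      ((2 : ℝ) ^ n)⁻¹ • ∑ σ, moments (cube n (l + 1) (child k σ)) φ := by
  rw [mem_bmoBallOn_iff ⟨l, k, rfl⟩ hε] at hφ
  apply Prod.ext
  · simp only [Prod.smul_fst, Prod.fst_sum, smul_eq_mul]
    exact setAverage_cube_eq_sum hφ.1
  · simp only [Prod.smul_snd, Prod.snd_sum, smul_eq_mul]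
    exact setAverage_cube_eq_sum hφ.2.1

/-- The Bellman induction on dyadic levels. -/
lemma CandidateData.setLAverage_exp_levelAverage_le {ε ρ δ : ℝ}
    (h : CandidateData ((2 : ℝ) ^ n)⁻¹ ε ρ δ) (hδ : δ < 1) {φ : (Fin n → ℝ) → ℝ} (p : ℕ) :
    ∀ (l : ℤ) (k : Fin n → ℤ), φ ∈ bmoBallOn n (cube n l k) ε →
      ⨍⁻ t in cube n l k, ENNReal.ofReal (Real.exp (levelAverage φ (l + p) t)) ∂volume ≤
        ENNReal.ofReal (Bfun δ (moments (cube n l k) φ)) := by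
  have hB : ∀ (l : ℤ) (k : Fin n → ℤ), φ ∈ bmoBallOn n (cube n l k) ε →
      moments (cube n l k) φ ∈ strip ε := fun l k hφ =>
    moments_mem_strip ⟨l, k, rfl⟩ h.ε_pos.le hφ
  induction p with
  | zero =>
    intro l k hφ
    have e : ∀ t ∈ cube n l k, ENNReal.ofReal (Real.exp (levelAverage φ (l + (0 : ℕ)) t)) =
        ENNReal.ofReal (Real.exp (moments (cube n l k) φ).1) := by
      intro t ht
      rw [Nat.cast_zero, add_zero, levelAverage, cubeIndex_eq ht, moments]
    rw [setLAverage_eq, setLIntegral_congr_fun (measurableSet_cube l k) e, setLIntegral_const,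
      ENNReal.mul_div_cancel_right (volume_cube_ne_zero l k) (volume_cube_ne_top l k)]
    exact ENNReal.ofReal_le_ofReal (h.exp_le_Bfun hδ (hB l k hφ))
  | succ p ih =>
    intro l k hφ
    have hφσ : ∀ σ, φ ∈ bmoBallOn n (cube n (l + 1) (child k σ)) ε := fun σ =>
      bmoBallOn_mono_set (child_subset l k σ) hφ
    have e : l + ((p + 1 : ℕ) : ℤ) = l + 1 + (p : ℤ) := by push_cast; ring
    rw [setLAverage_cube_eq_sum, e]
    have hpos : ∀ σ ∈ Finset.univ, 0 ≤ Bfun δ (moments (cube n (l + 1) (child k σ)) φ) :=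
      fun σ _ => (Real.exp_pos _).le.trans (h.exp_le_Bfun hδ (hB _ _ (hφσ σ)))
    calc _ ≤ ((2 : ℝ≥0∞) ^ n)⁻¹ *
          ∑ σ, ENNReal.ofReal (Bfun δ (moments (cube n (l + 1) (child k σ)) φ)) := by
          gcongr with σ _
          exact ih _ _ (hφσ σ)
      _ = ENNReal.ofReal (((2 : ℝ) ^ n)⁻¹ *
          ∑ σ, Bfun δ (moments (cube n (l + 1) (child k σ)) φ)) := by
          rw [ENNReal.ofReal_mul (by positivity), ENNReal.ofReal_sum_of_nonneg hpos,
            ENNReal.ofReal_inv_of_pos (by positivity), ENNReal.ofReal_pow (by norm_num)]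
          simp
      _ ≤ _ := by
          apply ENNReal.ofReal_le_ofReal
          have hm := moments_cube_eq_sum h.ε_pos.le hφ
          have hcard : (Finset.univ : Finset (Fin n → Fin 2)).card = (2 ^ n - 1) + 1 := by
            have := Nat.one_le_two_pow (n := n)
            simp only [Finset.card_univ, Fintype.card_fun, Fintype.card_fin]
            omega
          have hc : (((2 ^ n - 1 : ℕ) : ℝ) + 1) = 2 ^ n := by
            have := Nat.one_le_two_pow (n := n)
            push_cast [this]
            ring
          have := h.sum_le hδ (fun σ => moments (cube n (l + 1) (child k σ)) φ) (2 ^ n - 1)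
            Finset.univ hcard (by rw [hc]; exact (inv_mul_cancel₀ (by positivity)).le)
            (fun σ _ => hB _ _ (hφσ σ)) (by rw [hc, ← hm]; exact hB l k hφ)
          rw [hc, ← hm] at this
          exact this

/-- Every function of the `BMO` ball has its exponential average below the candidate. -/
theorem CandidateData.expAverage_le {ε ρ δ : ℝ} (h : CandidateData ((2 : ℝ) ^ n)⁻¹ ε ρ δ)
    (hδ : δ < 1) {Q : Set (Fin n → ℝ)} (hQ : Q ∈ dyadicCubes n) {φ : (Fin n → ℝ) → ℝ}
    (hφ : φ ∈ bmoBallOn n Q ε) :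
    expAverage Q φ ≤ ENNReal.ofReal (Bfun δ (moments Q φ)) := by
  obtain ⟨l, k, rfl⟩ := hQ
  have hv0 := volume_cube_ne_zero l k
  have hvt := volume_cube_ne_top l k
  have hae := ae_tendsto_levelAverage hφ.1
  have hm : ∀ p : ℕ, Measurable
      (fun t => ENNReal.ofReal (Real.exp (levelAverage φ (l + p) t))) := fun p =>
    (Real.measurable_exp.comp (measurable_levelAverage φ _)).ennreal_ofReal
  rw [expAverage, setLAverage_eq, ENNReal.div_le_iff hv0 hvt]
  have e : ∫⁻ t in cube n l k, ENNReal.ofReal (Real.exp (φ t)) =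
      ∫⁻ t in cube n l k, Filter.liminf
        (fun p : ℕ => ENNReal.ofReal (Real.exp (levelAverage φ (l + p) t))) Filter.atTop := by
    apply lintegral_congr_ae
    filter_upwards [hae] with t ht
    have h1 := (ENNReal.continuous_ofReal.comp Real.continuous_exp).continuousAt.tendsto.comp ht
    exact h1.liminf_eq.symm
  rw [e]
  refine (lintegral_liminf_le hm).trans ?_
  refine Filter.liminf_le_of_le (by isBoundedDefault) fun b hb => ?_
  obtain ⟨p, hp⟩ := hb.exists
  refine hp.trans ?_
  have := h.setLAverage_exp_levelAverage_le hδ p l k hφ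
  rwa [setLAverage_eq, ENNReal.div_le_iff hv0 hvt] at this

end Level

/-! ### Gluing test functions -/

section Glue

variable {n : ℕ}

/-- The value `v` is the exponential average of a test function for the Bellman problem on `Q` at
the point `x`. -/
def Attained (ε : ℝ) (Q : Set (Fin n → ℝ)) (x : ℝ × ℝ) (v : ℝ) : Prop :=
  ∃ φ ∈ bmoBallOn n Q ε, moments Q φ = x ∧ expAverage Q φ = ENNReal.ofReal v

lemma Attained.le_bellman {ε : ℝ} {Q : Set (Fin n → ℝ)} {x : ℝ × ℝ} {v : ℝ}
    (h : Attained ε Q x v) : ENNReal.ofReal v ≤ bellman n Q ε x := by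
  obtain ⟨φ, hφ, rfl, hv⟩ := h
  exact le_sSup ⟨φ, hφ, rfl, rfl, hv.symm⟩

lemma measurableSet_of_mem_dyadicCubes {J : Set (Fin n → ℝ)} (hJ : J ∈ dyadicCubes n) :
    MeasurableSet J := by
  obtain ⟨m, k, rfl⟩ := hJ
  exact measurableSet_cube m k

lemma setAverage_congr_eqOn {J : Set (Fin n → ℝ)} (hJ : J ∈ dyadicCubes n)
    {f g : (Fin n → ℝ) → ℝ} (h : EqOn f g J) : ⨍ t in J, f t = ⨍ t in J, g t := by
  rw [setAverage_eq, setAverage_eq,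
    setIntegral_congr_fun (measurableSet_of_mem_dyadicCubes hJ) h]

lemma moments_congr {J : Set (Fin n → ℝ)} (hJ : J ∈ dyadicCubes n) {φ ψ : (Fin n → ℝ) → ℝ}
    (h : EqOn φ ψ J) : moments J φ = moments J ψ := by
  unfold moments
  rw [setAverage_congr_eqOn hJ h, setAverage_congr_eqOn hJ
    (f := fun t => φ t ^ 2) (g := fun t => ψ t ^ 2) fun t ht => by simp only [h ht]]

lemma expAverage_congr {J : Set (Fin n → ℝ)} (hJ : J ∈ dyadicCubes n) {φ ψ : (Fin n → ℝ) → ℝ}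
    (h : EqOn φ ψ J) : expAverage J φ = expAverage J ψ := by
  unfold expAverage
  rw [setLAverage_eq, setLAverage_eq, setLIntegral_congr_fun (measurableSet_of_mem_dyadicCubes hJ)
    (g := fun t => ENNReal.ofReal (Real.exp (ψ t))) fun t ht => by simp only [h ht]]

lemma bmoBallOn_congr {Q : Set (Fin n → ℝ)} (hQ : Q ∈ dyadicCubes n) {ε : ℝ} (hε : 0 ≤ ε)
    {φ ψ : (Fin n → ℝ) → ℝ} (h : EqOn φ ψ Q) (hφ : φ ∈ bmoBallOn n Q ε) :
    ψ ∈ bmoBallOn n Q ε := by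
  have hQm := measurableSet_of_mem_dyadicCubes hQ
  rw [mem_bmoBallOn_iff hQ hε] at hφ ⊢
  refine ⟨hφ.1.congr_fun h hQm, hφ.2.1.congr_fun (fun t ht => by simp only [h ht]) hQm,
    fun J hJ => ?_⟩
  rw [← moments_congr hJ.1 (h.mono hJ.2)]
  exact hφ.2.2 J hJ

lemma moments_const {J : Set (Fin n → ℝ)} (hJ : J ∈ dyadicCubes n) (c : ℝ) :
    moments J (fun _ => c) = (c, c ^ 2) := by
  unfold moments
  rw [setAverage_const_cube hJ, setAverage_const_cube hJ]

lemma expAverage_const {J : Set (Fin n → ℝ)} (hJ : J ∈ dyadicCubes n) (c : ℝ) :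
    expAverage J (fun _ => c) = ENNReal.ofReal (Real.exp c) := by
  obtain ⟨m, k, rfl⟩ := hJ
  rw [expAverage, setLAverage_const (volume_cube_ne_zero m k) (volume_cube_ne_top m k)]

lemma attained_const {ε : ℝ} (hε : 0 ≤ ε) {Q : Set (Fin n → ℝ)} (hQ : Q ∈ dyadicCubes n) (c : ℝ) :
    Attained ε Q (c, c ^ 2) (Real.exp c) := by
  refine ⟨fun _ => c, ?_, moments_const hQ c, expAverage_const hQ c⟩
  have hi : ∀ c : ℝ, IntegrableOn (fun _ => c) Q volume := by
    obtain ⟨m, k, rfl⟩ := hQ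
    exact fun c => integrableOn_const (volume_cube_ne_top m k)
  rw [mem_bmoBallOn_iff hQ hε]
  refine ⟨hi c, hi (c ^ 2), fun J hJ => ?_⟩
  rw [moments_const hJ.1]
  simp only [var, sub_self]
  positivity

/-- Test functions on the children of a cube glue to a test function on the cube, as soon as the
variance over the whole cube is admissible. -/
lemma attained_glue {ε : ℝ} (hε : 0 ≤ ε) {l : ℤ} {k : Fin n → ℤ} {x : (Fin n → Fin 2) → ℝ × ℝ}
    {v : (Fin n → Fin 2) → ℝ} (hv : ∀ σ, 0 ≤ v σ)
    (h : ∀ σ, Attained ε (cube n (l + 1) (child k σ)) (x σ) (v σ))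
    (hvar : var (((2 : ℝ) ^ n)⁻¹ • ∑ σ, x σ) ≤ ε ^ 2) :
    Attained ε (cube n l k) (((2 : ℝ) ^ n)⁻¹ • ∑ σ, x σ) (((2 : ℝ) ^ n)⁻¹ * ∑ σ, v σ) := by
  choose φ hφ hx hφv using h
  have hmem := fun σ => child_mem_dyadicCubes l k σ
  set ψ : (Fin n → ℝ) → ℝ := fun t => ∑ σ, (cube n (l + 1) (child k σ)).indicator (φ σ) t with hψ
  have heq : ∀ σ, EqOn (φ σ) ψ (cube n (l + 1) (child k σ)) := by
    intro σ t ht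
    simp only [hψ]
    rw [Finset.sum_eq_single σ]
    · rw [indicator_of_mem ht]
    · intro τ _ hτ
      exact indicator_of_notMem (fun ht' => (child_disjoint l k hτ).le_bot ⟨ht', ht⟩) _
    · intro hσ; exact absurd (Finset.mem_univ σ) hσ
  have hψσ : ∀ σ, ψ ∈ bmoBallOn n (cube n (l + 1) (child k σ)) ε := fun σ =>
    bmoBallOn_congr (hmem σ) hε (heq σ) (hφ σ)
  have hψσ' := fun σ => (mem_bmoBallOn_iff (hmem σ) hε).1 (hψσ σ)
  have hψ1 := integrableOn_cube_of_child fun σ => (hψσ' σ).1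
  have hψ2 := integrableOn_cube_of_child fun σ => (hψσ' σ).2.1
  have hmom : moments (cube n l k) ψ = ((2 : ℝ) ^ n)⁻¹ • ∑ σ, x σ := by
    have e : ∀ σ, moments (cube n (l + 1) (child k σ)) ψ = x σ := fun σ => by
      rw [← moments_congr (hmem σ) (heq σ), hx]
    simp only [← e]
    apply Prod.ext
    · simp only [Prod.smul_fst, Prod.fst_sum, smul_eq_mul]
      exact setAverage_cube_eq_sum hψ1
    · simp only [Prod.smul_snd, Prod.snd_sum, smul_eq_mul]
      exact setAverage_cube_eq_sum hψ2
  refine ⟨ψ, ?_, hmom, ?_⟩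
  · rw [mem_bmoBallOn_iff ⟨l, k, rfl⟩ hε]
    refine ⟨hψ1, hψ2, fun J hJ => ?_⟩
    rcases eq_or_subset_child hJ with rfl | ⟨σ, hσ⟩
    · rwa [hmom]
    · exact (hψσ' σ).2.2 J ⟨hJ.1, hσ⟩
  · rw [expAverage, setLAverage_cube_eq_sum, ENNReal.ofReal_mul (by positivity),
      ENNReal.ofReal_sum_of_nonneg fun σ _ => hv σ, ENNReal.ofReal_inv_of_pos (by positivity),
      ENNReal.ofReal_pow (by norm_num)]
    congr 1
    · simp
    · refine Finset.sum_congr rfl fun σ _ => ?_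
      rw [← hφv σ, expAverage_congr (hmem σ) (heq σ), expAverage]

/-- Gluing with one exceptional child. -/
lemma attained_glue_one {ε : ℝ} (hε : 0 ≤ ε) {Q : Set (Fin n → ℝ)} (hQ : Q ∈ dyadicCubes n)
    {x y : ℝ × ℝ} {v w : ℝ} (hv : 0 ≤ v) (hw : 0 ≤ w)
    (hx : ∀ R ∈ dyadicCubes n, Attained ε R x v) (hy : ∀ R ∈ dyadicCubes n, Attained ε R y w)
    (hvar : var (((2 : ℝ) ^ n)⁻¹ • x + (1 - ((2 : ℝ) ^ n)⁻¹) • y) ≤ ε ^ 2) :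
    Attained ε Q (((2 : ℝ) ^ n)⁻¹ • x + (1 - ((2 : ℝ) ^ n)⁻¹) • y)
      (((2 : ℝ) ^ n)⁻¹ * v + (1 - ((2 : ℝ) ^ n)⁻¹) * w) := by
  obtain ⟨l, k, rfl⟩ := hQ
  have h2 : (2 : ℝ) ^ n ≠ 0 := by positivity
  have hc : (((Finset.univ : Finset (Fin n → Fin 2)).erase 0).card : ℝ) = 2 ^ n - 1 := by
    rw [Finset.card_erase_of_mem (Finset.mem_univ _), Nat.cast_sub (by simp [Finset.card_univ, Nat.one_le_two_pow])]
    simp [Finset.card_univ]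
  have e1 : ((2 : ℝ) ^ n)⁻¹ • ∑ σ : Fin n → Fin 2, (if σ = 0 then x else y) =
      ((2 : ℝ) ^ n)⁻¹ • x + (1 - ((2 : ℝ) ^ n)⁻¹) • y := by
    rw [← Finset.add_sum_erase _ _ (Finset.mem_univ 0), if_pos rfl,
      Finset.sum_congr rfl (g := fun _ => y) fun σ hσ => if_neg (Finset.ne_of_mem_erase hσ),
      Finset.sum_const, ← Nat.cast_smul_eq_nsmul ℝ, hc, smul_add, smul_smul]
    congr 2
    field_simp
  have e2 : ((2 : ℝ) ^ n)⁻¹ * ∑ σ : Fin n → Fin 2, (if σ = 0 then v else w) =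
      ((2 : ℝ) ^ n)⁻¹ * v + (1 - ((2 : ℝ) ^ n)⁻¹) * w := by
    rw [← Finset.add_sum_erase _ _ (Finset.mem_univ 0), if_pos rfl,
      Finset.sum_congr rfl (g := fun _ => w) fun σ hσ => if_neg (Finset.ne_of_mem_erase hσ),
      Finset.sum_const, nsmul_eq_mul, hc]
    field_simp
  rw [← e1] at hvar ⊢
  rw [← e2]
  refine attained_glue hε (fun σ => ?_) (fun σ => ?_) hvar
  · split_ifs <;> assumption
  · split_ifs
    · exact hx _ (child_mem_dyadicCubes l k σ)
    · exact hy _ (child_mem_dyadicCubes l k σ)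

lemma exists_sum_eq_of_le {ι : Type*} [DecidableEq ι] (s : Finset ι) (M : ℕ) :
    ∀ a : ℕ, a ≤ s.card * M → ∃ f : ι → ℕ, (∀ i, f i ≤ M) ∧ ∑ i ∈ s, f i = a := by
  induction s using Finset.induction_on with
  | empty => exact fun a ha => ⟨fun _ => 0, by simp, by simp at ha ⊢; omega⟩
  | insert i s hi ih =>
    intro a ha
    rw [Finset.card_insert_of_notMem hi, add_mul, one_mul] at ha
    obtain ⟨f, hf, hs⟩ := ih (a - min a M) (by omega)
    refine ⟨fun j => if j = i then min a M else f j, fun j => ?_, ?_⟩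
    · dsimp only; split_ifs
      · exact min_le_right _ _
      · exact hf j
    · rw [Finset.sum_insert hi, if_pos rfl, Finset.sum_congr rfl
        (g := f) fun j hj => if_neg (ne_of_mem_of_not_mem hj hi), hs]
      omega

/-- The points of the segment between a point of the lower boundary and a point of the strip
at which a value is attained, with `2ⁿ`-adic weights. -/
lemma attained_segment {ε : ℝ} (hε : 0 ≤ ε) {x y : ℝ × ℝ} {v w : ℝ} (hv : 0 ≤ v) (hw : 0 ≤ w)
    (hx : ∀ R ∈ dyadicCubes n, Attained ε R x v) (hy : ∀ R ∈ dyadicCubes n, Attained ε R y w)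
    (hvar : ∀ s : ℝ, 0 ≤ s → s ≤ 1 → var (s • x + (1 - s) • y) ≤ ε ^ 2) (p : ℕ) :
    ∀ a : ℕ, a ≤ (2 ^ n) ^ p → ∀ Q ∈ dyadicCubes n,
      Attained ε Q (((a : ℝ) / (2 ^ n) ^ p) • x + (1 - (a : ℝ) / (2 ^ n) ^ p) • y)
        (((a : ℝ) / (2 ^ n) ^ p) * v + (1 - (a : ℝ) / (2 ^ n) ^ p) * w) := by
  induction p with
  | zero =>
    intro a ha Q hQ
    rw [pow_zero] at ha
    interval_cases a
    · simpa using hy Q hQ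
    · simpa using hx Q hQ
  | succ p ih =>
    intro a ha Q hQ
    obtain ⟨l, k, rfl⟩ := hQ
    obtain ⟨f, hf, hfs⟩ := exists_sum_eq_of_le (Finset.univ : Finset (Fin n → Fin 2))
      ((2 ^ n) ^ p) a (by simpa [Finset.card_univ, pow_succ, mul_comm] using ha)
    have h2 : (2 : ℝ) ^ n ≠ 0 := by positivity
    have hs : ((2 : ℝ) ^ n)⁻¹ * ∑ σ, ((f σ : ℝ) / (2 ^ n) ^ p) = (a : ℝ) / (2 ^ n) ^ (p + 1) := by
      rw [← Finset.sum_div, ← Nat.cast_sum, hfs, pow_succ]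
      field_simp
    have hs' : ((2 : ℝ) ^ n)⁻¹ * ∑ σ, (1 - (f σ : ℝ) / (2 ^ n) ^ p) =
        1 - (a : ℝ) / (2 ^ n) ^ (p + 1) := by
      rw [Finset.sum_sub_distrib, mul_sub, hs]
      simp [Finset.card_univ]
    have e1 : ((2 : ℝ) ^ n)⁻¹ • ∑ σ, (((f σ : ℝ) / (2 ^ n) ^ p) • x +
        (1 - (f σ : ℝ) / (2 ^ n) ^ p) • y) =
        ((a : ℝ) / (2 ^ n) ^ (p + 1)) • x + (1 - (a : ℝ) / (2 ^ n) ^ (p + 1)) • y := by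
      rw [Finset.sum_add_distrib, ← Finset.sum_smul, ← Finset.sum_smul, smul_add, smul_smul,
        smul_smul, hs, hs']
    have e2 : ((2 : ℝ) ^ n)⁻¹ * ∑ σ, (((f σ : ℝ) / (2 ^ n) ^ p) * v +
        (1 - (f σ : ℝ) / (2 ^ n) ^ p) * w) =
        ((a : ℝ) / (2 ^ n) ^ (p + 1)) * v + (1 - (a : ℝ) / (2 ^ n) ^ (p + 1)) * w := by
      rw [Finset.sum_add_distrib, ← Finset.sum_mul, ← Finset.sum_mul, mul_add, ← mul_assoc,
        ← mul_assoc, hs, hs']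
    have hfr : ∀ (q b : ℕ), b ≤ (2 ^ n) ^ q → (b : ℝ) / (2 ^ n) ^ q ≤ 1 := fun q b hb => by
      rw [div_le_one (by positivity)]; exact_mod_cast hb
    rw [← e1, ← e2]
    refine attained_glue hε (fun σ => ?_)
      (fun σ => ih (f σ) (hf σ) _ (child_mem_dyadicCubes l k σ)) ?_
    · exact add_nonneg (mul_nonneg (by positivity) hv)
        (mul_nonneg (sub_nonneg.2 (hfr _ _ (hf σ))) hw)
    · rw [e1]
      exact hvar _ (by positivity) (hfr _ _ ha)

/-! ### The extremal functions on the upper boundary -/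

/-- Exponential averages of the approximate extremal functions of mean zero and variance `ε²`. Each
of them is constant on all children of the cube but one, on which it is a shift of the previous
one. -/
def topValue (n : ℕ) (ε : ℝ) : ℕ → ℝ
  | 0 => ((2 : ℝ) ^ n)⁻¹ * Real.exp (√(2 ^ n - 1) * ε) +
      (1 - ((2 : ℝ) ^ n)⁻¹) * Real.exp (-(ε / √(2 ^ n - 1)))
  | m + 1 => ((2 : ℝ) ^ n)⁻¹ * (Real.exp (ε / √((2 : ℝ) ^ n)⁻¹ - √((2 : ℝ) ^ n)⁻¹ * ε) *
      topValue n ε m) + (1 - ((2 : ℝ) ^ n)⁻¹) * Real.exp (-(√((2 : ℝ) ^ n)⁻¹ * ε))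

lemma inv_two_pow_lt_one (hn : 1 ≤ n) : ((2 : ℝ) ^ n)⁻¹ < 1 :=
  inv_lt_one_of_one_lt₀ (one_lt_pow₀ (by norm_num) (by omega))

lemma topValue_pos (hn : 1 ≤ n) (ε : ℝ) (m : ℕ) : 0 < topValue n ε m := by
  have h1 : 0 < 1 - ((2 : ℝ) ^ n)⁻¹ := sub_pos.2 (inv_two_pow_lt_one hn)
  induction m with
  | zero => unfold topValue; positivity
  | succ m ih => unfold topValue; positivity

lemma attained_top (hn : 1 ≤ n) {ε : ℝ} (hε : 0 ≤ ε) (m : ℕ) :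
    ∀ (c : ℝ), ∀ Q ∈ dyadicCubes n,
      Attained ε Q (c, c ^ 2 + ε ^ 2) (Real.exp c * topValue n ε m) := by
  have h1 : 0 < 1 - ((2 : ℝ) ^ n)⁻¹ := sub_pos.2 (inv_two_pow_lt_one hn)
  have hN : 0 < (2 : ℝ) ^ n - 1 := sub_pos.2 (one_lt_pow₀ (by norm_num) (by omega))
  induction m with
  | zero =>
    intro c Q hQ
    set b := √((2 : ℝ) ^ n - 1) with hb
    have hb0 : 0 < b := Real.sqrt_pos.2 hN
    have hb2 : (2 : ℝ) ^ n = b ^ 2 + 1 := by rw [hb, Real.sq_sqrt hN.le]; ring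
    have ex : ((2 : ℝ) ^ n)⁻¹ • ((c + b * ε, (c + b * ε) ^ 2) : ℝ × ℝ) +
        (1 - ((2 : ℝ) ^ n)⁻¹) • ((c - ε / b, (c - ε / b) ^ 2) : ℝ × ℝ) = (c, c ^ 2 + ε ^ 2) := by
      have : b ^ 2 + 1 ≠ 0 := by positivity
      rw [hb2]
      apply Prod.ext
      · simp only [Prod.fst_add, Prod.smul_fst, smul_eq_mul]; field_simp; ring
      · simp only [Prod.snd_add, Prod.smul_snd, smul_eq_mul]; field_simp; ring
    have := attained_glue_one hε hQ (Real.exp_pos _).le (Real.exp_pos _).le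
      (fun R hR => attained_const hε hR (c + b * ε)) (fun R hR => attained_const hε hR (c - ε / b))
      (by rw [ex]; simp [var])
    rw [ex] at this
    convert this using 1
    rw [topValue, Real.exp_add, sub_eq_add_neg c, Real.exp_add]
    ring
  | succ m ih =>
    intro c Q hQ
    set a := √((2 : ℝ) ^ n)⁻¹ with ha
    have hα0 : 0 < ((2 : ℝ) ^ n)⁻¹ := by positivity
    have ha0 : 0 < a := Real.sqrt_pos.2 hα0
    have ha2 : ((2 : ℝ) ^ n)⁻¹ = a ^ 2 := (Real.sq_sqrt hα0.le).symm
    have ex : ((2 : ℝ) ^ n)⁻¹ • ((c + (ε / a - a * ε), (c + (ε / a - a * ε)) ^ 2 + ε ^ 2) : ℝ × ℝ) +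
        (1 - ((2 : ℝ) ^ n)⁻¹) • ((c - a * ε, (c - a * ε) ^ 2) : ℝ × ℝ) = (c, c ^ 2 + ε ^ 2) := by
      rw [ha2]
      apply Prod.ext
      · simp only [Prod.fst_add, Prod.smul_fst, smul_eq_mul]; field_simp; ring
      · simp only [Prod.snd_add, Prod.smul_snd, smul_eq_mul]; field_simp; ring
    have := attained_glue_one hε hQ (mul_pos (Real.exp_pos _) (topValue_pos hn ε m)).le
      (Real.exp_pos _).le (fun R hR => ih (c + (ε / a - a * ε)) R hR)
      (fun R hR => attained_const hε hR (c - a * ε)) (by rw [ex]; simp [var])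
    rw [ex] at this
    convert this using 1
    rw [topValue, Real.exp_add c, sub_eq_add_neg c, Real.exp_add c]
    ring

lemma topValue_succ (n : ℕ) (ε : ℝ) (m : ℕ) : topValue n ε (m + 1) =
    ((2 : ℝ) ^ n)⁻¹ * Real.exp (ε / √((2 : ℝ) ^ n)⁻¹ - √((2 : ℝ) ^ n)⁻¹ * ε) * topValue n ε m +
      (1 - ((2 : ℝ) ^ n)⁻¹) * Real.exp (-(√((2 : ℝ) ^ n)⁻¹ * ε)) := by
  rw [topValue]; ring

lemma tendsto_topValue {ε : ℝ} (hs : Subcritical ((2 : ℝ) ^ n)⁻¹ ε) :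
    Filter.Tendsto (topValue n ε) Filter.atTop (nhds (K ((2 : ℝ) ^ n)⁻¹ ε)) := by
  have hrec := topValue_succ n ε
  have hα0 : 0 < ((2 : ℝ) ^ n)⁻¹ := by positivity
  set α := ((2 : ℝ) ^ n)⁻¹
  set q := α * Real.exp (ε / √α - √α * ε) with hq
  have hq0 : 0 ≤ q := by positivity
  have hq1 : q < 1 := by
    rw [hq, sub_eq_add_neg, Real.exp_add, Real.exp_neg, ← mul_assoc, ← div_eq_mul_inv,
      div_lt_one (Real.exp_pos _)]
    exact hs
  have hK : K α ε = q * K α ε + (1 - α) * Real.exp (-(√α * ε)) := by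
    have hden : Real.exp (√α * ε) - α * Real.exp (ε / √α) ≠ 0 := (sub_pos.2 hs).ne'
    rw [K, hq, sub_eq_add_neg (ε / √α), Real.exp_add, Real.exp_neg]
    field_simp
    ring
  have hv : ∀ m, topValue n ε m = K α ε + q ^ m * (topValue n ε 0 - K α ε) := by
    intro m
    induction m with
    | zero => simp
    | succ m ih =>
      rw [hrec, ih, pow_succ]
      linear_combination -hK
  rw [funext hv]
  simpa using ((tendsto_pow_atTop_nhds_zero_of_lt_one hq0 hq1).mul_const
    (topValue n ε 0 - K α ε)).const_add (K α ε)

lemma tendsto_topValue_atTop (hn : 1 ≤ n) {ε : ℝ} (hs : ¬ Subcritical ((2 : ℝ) ^ n)⁻¹ ε) :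
    Filter.Tendsto (topValue n ε) Filter.atTop Filter.atTop := by
  have hrec := topValue_succ n ε
  have hpos := topValue_pos hn ε
  have hα1 : 0 < 1 - ((2 : ℝ) ^ n)⁻¹ := sub_pos.2 (inv_two_pow_lt_one hn)
  set α := ((2 : ℝ) ^ n)⁻¹
  have hq1 : 1 ≤ α * Real.exp (ε / √α - √α * ε) := by
    rw [sub_eq_add_neg, Real.exp_add, Real.exp_neg, ← mul_assoc, ← div_eq_mul_inv,
      one_le_div (Real.exp_pos _)]
    exact not_lt.1 hs
  have hA : 0 < (1 - α) * Real.exp (-(√α * ε)) := by positivity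
  have hv : ∀ m : ℕ, (m : ℝ) * ((1 - α) * Real.exp (-(√α * ε))) ≤ topValue n ε m := by
    intro m
    induction m with
    | zero => simpa using (hpos 0).le
    | succ m ih =>
      rw [hrec]
      have := mul_le_mul_of_nonneg_right hq1 (hpos m).le
      push_cast
      linarith
  exact Filter.tendsto_atTop_mono hv (tendsto_natCast_atTop_atTop.atTop_mul_const hA)

/-! ### Test functions inside the strip -/

/-- A point inside the strip lies on chords from the lower to the upper boundary, dividing them in
ratios `s p` that are `2ⁿ`-adic and converge to a given admissible ratio. -/
lemma exists_attained_interior (hn : 1 ≤ n) {ε : ℝ} (hε : 0 < ε) {Q : Set (Fin n → ℝ)}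
    (hQ : Q ∈ dyadicCubes n) {t h : ℝ} (ht0 : 0 < t) (ht1 : t < 1) (hh0 : 0 ≤ h) (hh : h < ε)
    {x : ℝ × ℝ} (hx : var x = t * ε ^ 2 + t * (1 - t) * h ^ 2) :
    ∃ s H : ℕ → ℝ, Filter.Tendsto s Filter.atTop (nhds t) ∧
      Filter.Tendsto H Filter.atTop (nhds h) ∧ ∀ᶠ p in Filter.atTop, 0 < s p ∧ s p < 1 ∧
        0 ≤ H p ∧ Attained ε Q x (s p * (Real.exp (x.1 + (1 - s p) * H p) * topValue n ε p) +
          (1 - s p) * Real.exp (x.1 - s p * H p)) := by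
  obtain ⟨s, hs⟩ : ∃ s : ℕ → ℝ, ∀ p, s p = (⌊t * ((2 : ℝ) ^ n) ^ p⌋₊ : ℝ) / (2 ^ n) ^ p :=
    ⟨_, fun _ => rfl⟩
  obtain ⟨H, hH⟩ : ∃ H : ℕ → ℝ, ∀ p, H p = √((var x - s p * ε ^ 2) / (s p * (1 - s p))) :=
    ⟨_, fun _ => rfl⟩
  have hst : Filter.Tendsto s Filter.atTop (nhds t) := by
    have h1 : Filter.Tendsto (fun p : ℕ => ((2 : ℝ) ^ n) ^ p) Filter.atTop Filter.atTop :=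
      tendsto_pow_atTop_atTop_of_one_lt (one_lt_pow₀ (by norm_num) (by omega))
    rw [funext hs]
    exact (tendsto_nat_floor_mul_div_atTop ht0.le).comp h1
  have hne : t * (1 - t) ≠ 0 := by
    have : 0 < 1 - t := by linarith
    positivity
  have hHt : Filter.Tendsto H Filter.atTop (nhds h) := by
    have h1 := ((hst.mul_const (ε ^ 2)).const_sub (var x)).div (hst.mul (hst.const_sub 1)) hne
    have h2 := (Real.continuous_sqrt.tendsto _).comp h1
    have e : √((var x - t * ε ^ 2) / (t * (1 - t))) = h := by
      rw [hx, add_sub_cancel_left, mul_div_cancel_left₀ _ hne, Real.sqrt_sq hh0]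
    rw [e] at h2
    rw [funext hH]
    exact h2
  refine ⟨s, H, hst, hHt, ?_⟩
  filter_upwards [hst.eventually (lt_mem_nhds ht0), hst.eventually (gt_mem_nhds ht1),
    hHt.eventually (gt_mem_nhds hh)] with p hp0 hp1 hpH
  have hH0 : 0 ≤ H p := by rw [hH]; exact Real.sqrt_nonneg _
  refine ⟨hp0, hp1, hH0, ?_⟩
  have hsle : s p ≤ t := by
    rw [hs, div_le_iff₀ (by positivity)]
    exact Nat.floor_le (by positivity)
  have hsp : 0 < s p * (1 - s p) := mul_pos hp0 (by linarith)
  have hH2 : s p * (1 - s p) * H p ^ 2 = var x - s p * ε ^ 2 := by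
    rw [hH, Real.sq_sqrt, mul_div_cancel₀ _ hsp.ne']
    apply div_nonneg _ hsp.le
    have h1 : s p * ε ^ 2 ≤ t * ε ^ 2 := mul_le_mul_of_nonneg_right hsle (sq_nonneg _)
    have h2 : 0 ≤ t * (1 - t) * h ^ 2 :=
      mul_nonneg (mul_nonneg ht0.le (by linarith)) (sq_nonneg _)
    linarith
  have hfl : ⌊t * ((2 : ℝ) ^ n) ^ p⌋₊ ≤ (2 ^ n) ^ p := by
    apply Nat.floor_le_of_le
    push_cast
    exact mul_le_of_le_one_left (by positivity) ht1.le
  have := attained_segment hε.le (mul_pos (Real.exp_pos _) (topValue_pos hn ε p)).le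
    (Real.exp_pos _).le (fun R hR => attained_top hn hε.le p (x.1 + (1 - s p) * H p) R hR)
    (fun R hR => attained_const hε.le hR (x.1 - s p * H p)) (fun r hr0 hr1 => by
      have e : var (r • ((x.1 + (1 - s p) * H p, (x.1 + (1 - s p) * H p) ^ 2 + ε ^ 2) : ℝ × ℝ) +
          (1 - r) • ((x.1 - s p * H p, (x.1 - s p * H p) ^ 2) : ℝ × ℝ)) =
          r * ε ^ 2 + r * (1 - r) * H p ^ 2 := by
        simp only [var, Prod.fst_add, Prod.smul_fst, Prod.snd_add, Prod.smul_snd, smul_eq_mul]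
        ring
      rw [e]
      have h1 : H p ^ 2 ≤ ε ^ 2 := pow_le_pow_left₀ hH0 hpH.le 2
      have h2 := mul_le_mul_of_nonneg_left h1 (mul_nonneg hr0 (sub_nonneg.2 hr1))
      have h3 : 0 ≤ (1 - r) ^ 2 * ε ^ 2 := by positivity
      nlinarith) p _ hfl Q hQ
  rw [← hs] at this
  convert this using 1
  apply Prod.ext
  · simp only [Prod.fst_add, Prod.smul_fst, smul_eq_mul]; ring
  · simp only [Prod.snd_add, Prod.smul_snd, smul_eq_mul]
    have hvx : x.2 = var x + x.1 ^ 2 := by simp [var]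
    rw [hvx]
    linear_combination -hH2

end Glue

/-! ### The sharp constant -/

section Sharp

variable {n : ℕ}

/-- Extension by the mean value preserves the `BMO` bound. -/
lemma exists_extension {ε : ℝ} (hε : 0 ≤ ε) {Q : Set (Fin n → ℝ)} (hQ : Q ∈ dyadicCubes n)
    {φ : (Fin n → ℝ) → ℝ} (hφ : φ ∈ bmoBallOn n Q ε) :
    ∃ ψ ∈ bmoBall n ε, EqOn φ ψ Q := by
  have hQm := measurableSet_of_mem_dyadicCubes hQ
  set m := ⨍ t in Q, φ t with hm
  set θ : (Fin n → ℝ) → ℝ := Q.indicator fun t => φ t - m with hθ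
  set ψ : (Fin n → ℝ) → ℝ := fun t => θ t + m with hψ
  have heq : EqOn φ ψ Q := fun t ht => by simp only [hψ, hθ, indicator_of_mem ht]; ring
  have hout : ∀ t ∉ Q, ψ t = m := fun t ht => by
    simp only [hψ, hθ, indicator_of_notMem ht, zero_add]
  have hψQ := bmoBallOn_congr hQ hε heq hφ
  have hφ' := (mem_bmoBallOn_iff hQ hε).1 hφ
  have hci : IntegrableOn (fun _ => m) Q volume := by
    obtain ⟨l, k, rfl⟩ := hQ
    exact integrableOn_const (volume_cube_ne_top l k)
  have hθ1 : Integrable θ := (hφ'.1.sub hci).integrable_indicator hQm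
  obtain ⟨hsqi, hsq⟩ := average_sub_sq hQ hφ'.1 hφ'.2.1 m
  have eθ : (fun t => θ t ^ 2) = Q.indicator fun t => (φ t - m) ^ 2 := by
    funext t
    by_cases ht : t ∈ Q <;> simp [hθ, ht]
  have hθ2 : Integrable (fun t => θ t ^ 2) := by
    rw [eθ]; exact hsqi.integrable_indicator hQm
  have hψ1 : ∀ J ∈ dyadicCubes n, IntegrableOn ψ J ∧ IntegrableOn (fun t => ψ t ^ 2) J := by
    intro J hJ
    obtain ⟨l, k, rfl⟩ := hJ
    have hc : ∀ c : ℝ, IntegrableOn (fun _ => c) (cube n l k) volume :=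
      fun c => integrableOn_const (volume_cube_ne_top l k)
    refine ⟨hθ1.integrableOn.add (hc m), ?_⟩
    have e : (fun t => ψ t ^ 2) = fun t => θ t ^ 2 + 2 * m * θ t + m ^ 2 := by
      funext t; simp only [hψ]; ring
    rw [e]
    exact (hθ2.integrableOn.add (hθ1.integrableOn.const_mul _)).add (hc _)
  refine ⟨ψ, ⟨hθ1.locallyIntegrable.add (locallyIntegrable_const m), ?_⟩, heq⟩
  rw [bmoNorm_le_iff hε]
  intro J hJ
  rw [oscillation_eq hJ (hψ1 J hJ).1 (hψ1 J hJ).2]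
  apply ENNReal.ofReal_le_ofReal
  by_cases hd : J ∩ Q = ∅
  · rw [moments_congr hJ (ψ := fun _ => m) fun t ht => hout t fun htQ =>
      (hd ▸ (⟨ht, htQ⟩ : t ∈ J ∩ Q) : t ∈ (∅ : Set _)), moments_const hJ]
    simp only [var, sub_self]; positivity
  by_cases hJQ : J ⊆ Q
  · exact ((mem_bmoBallOn_iff hQ hε).1 hψQ).2.2 J ⟨hJ, hJQ⟩
  have hQJ : Q ⊆ J := by
    obtain ⟨l, k, rfl⟩ := hQ
    obtain ⟨l', k', rfl⟩ := hJ
    have hne := nonempty_iff_ne_empty.2 hd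
    rcases le_total l l' with h | h
    · exact absurd (cube_subset_of_le h (by rwa [inter_comm])) hJQ
    · exact cube_subset_of_le h hne
  -- The variance over `J` is at most the mean square deviation from `m`, to which only `Q`
  -- contributes.
  have h1 := (average_sub_sq hJ (hψ1 J hJ).1 (hψ1 J hJ).2 m).2
  have h2 : ⨍ t in J, (ψ t - m) ^ 2 ≤ ⨍ t in Q, (φ t - m) ^ 2 := by
    have e1 : ∀ t, (ψ t - m) ^ 2 = Q.indicator (fun t => (φ t - m) ^ 2) t := fun t => by
      rw [← congrFun eθ t]; simp only [hψ]; ring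
    simp only [e1]
    rw [setAverage_eq, setAverage_eq, setIntegral_indicator hQm, inter_eq_self_of_subset_right hQJ]
    apply mul_le_mul_of_nonneg_right _ (integral_nonneg fun t => sq_nonneg _)
    obtain ⟨l, k, rfl⟩ := hQ
    obtain ⟨l', k', rfl⟩ := hJ
    apply inv_anti₀ (ENNReal.toReal_pos (volume_cube_ne_zero l k) (volume_cube_ne_top l k))
    exact ENNReal.toReal_mono (volume_cube_ne_top l' k') (measure_mono hQJ)
  have h3 := hφ'.2.2 Q ⟨hQ, subset_rfl⟩
  simp only [var, moments] at h3 ⊢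
  rw [← hm] at h3 hsq
  nlinarith [sq_nonneg ((⨍ t in J, ψ t) - m)]

lemma bmoBallOn_of_bmoBall {ε : ℝ} {Q : Set (Fin n → ℝ)} (hQ : Q ∈ dyadicCubes n)
    {φ : (Fin n → ℝ) → ℝ} (hφ : φ ∈ bmoBall n ε) : φ ∈ bmoBallOn n Q ε := by
  refine ⟨?_, le_trans ?_ hφ.2⟩
  · obtain ⟨l, k, rfl⟩ := hQ
    rw [cube_eq_ball]
    exact (hφ.1.integrableOn_isCompact (isCompact_closedBall _ _)).mono_set
      Metric.ball_subset_closedBall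
  · exact iSup₂_mono' fun J hJ => ⟨J, hJ.1, le_rfl⟩

lemma JohnNirenbergHolds.mono {ε ε' : ℝ} (h : JohnNirenbergHolds n ε') (hε : ε ≤ ε') :
    JohnNirenbergHolds n ε := by
  obtain ⟨C, hC, h⟩ := h
  exact ⟨C, hC, fun φ hφ => h φ ⟨hφ.1, hφ.2.trans (ENNReal.ofReal_le_ofReal hε)⟩⟩

lemma johnNirenbergHolds_of_subcritical (hn : 1 ≤ n) {ε : ℝ} (hε : 0 < ε)
    (hs : Subcritical ((2 : ℝ) ^ n)⁻¹ ε) : JohnNirenbergHolds n ε := by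
  have hα0 : 0 < ((2 : ℝ) ^ n)⁻¹ := by positivity
  obtain ⟨δ, hδ, -⟩ := existsUnique_isDelta hα0 (inv_two_pow_lt_one hn) hε hs
  have hδ1 : δ < 1 := hδ.2.2.trans_le (min_le_left _ _)
  have hp := profile_pos hδ1
  refine ⟨(profile δ)⁻¹, inv_pos.2 hp, fun φ hφ Q hQ => ?_⟩
  refine ((hδ.candidateData hα0 hε hs).expAverage_le hδ1 hQ (bmoBallOn_of_bmoBall hQ hφ)).trans ?_
  apply ENNReal.ofReal_le_ofReal
  rw [Bfun_eq]
  apply mul_le_mul_of_nonneg_left _ (inv_pos.2 hp).le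
  apply mul_le_of_le_one_right (Real.exp_pos _).le
  have := profile_anti le_rfl (Real.sqrt_nonneg (δ ^ 2 - var (moments Q φ)))
  simpa [profile] using this

lemma not_johnNirenbergHolds (hn : 1 ≤ n) {ε : ℝ} (hε : 0 ≤ ε)
    (hs : ¬ Subcritical ((2 : ℝ) ^ n)⁻¹ ε) : ¬ JohnNirenbergHolds n ε := by
  rintro ⟨C, hC, h⟩
  obtain ⟨p, hp⟩ := ((tendsto_topValue_atTop hn hs).eventually_gt_atTop C).exists
  have hQ : cube n 0 0 ∈ dyadicCubes n := ⟨0, 0, rfl⟩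
  obtain ⟨φ, hφ, hφm, hφv⟩ := attained_top hn hε p 0 _ hQ
  obtain ⟨ψ, hψ, heq⟩ := exists_extension hε hQ hφ
  have h1 := h ψ hψ _ hQ
  have h2 : ⨍ t in cube n 0 0, ψ t = 0 := by
    rw [← setAverage_congr_eqOn hQ heq]; exact congrArg Prod.fst hφm
  rw [← expAverage_congr hQ heq, hφv, h2, Real.exp_zero, one_mul, mul_one,
    ENNReal.ofReal_le_ofReal_iff hC.le] at h1
  linarith

/-- Below the sharp constant, and only there, the extremal functions have finite exponential
averages. -/
theorem lt_sharpEps_iff (hn : 1 ≤ n) {ε : ℝ} (hε : 0 < ε) :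
    ENNReal.ofReal ε < sharpEps n ↔ Subcritical ((2 : ℝ) ^ n)⁻¹ ε := by
  constructor
  · intro h
    obtain ⟨e, he, hlt⟩ := lt_sSup_iff.1 h
    by_contra hs
    exact not_johnNirenbergHolds hn hε.le hs (he ε hε.le hlt)
  · intro hs
    have hev : ∀ᶠ e in nhds ε, Subcritical ((2 : ℝ) ^ n)⁻¹ e := by
      have h1 : Continuous fun e => ((2 : ℝ) ^ n)⁻¹ * Real.exp (e / √((2 : ℝ) ^ n)⁻¹) := by fun_prop
      have h2 : Continuous fun e => Real.exp (√((2 : ℝ) ^ n)⁻¹ * e) := by fun_prop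
      exact (isOpen_lt h1 h2).mem_nhds hs
    obtain ⟨ε', hs', hε'⟩ := ((hev.filter_mono nhdsWithin_le_nhds).and
      (self_mem_nhdsWithin : Ioi ε ∈ nhdsWithin ε (Ioi ε))).exists
    have hε'0 : 0 < ε' := hε.trans hε'
    refine lt_of_lt_of_le ((ENNReal.ofReal_lt_ofReal_iff hε'0).2 hε') (le_sSup ?_)
    intro e _ he
    exact (johnNirenbergHolds_of_subcritical hn hε'0 hs').mono
      ((ENNReal.ofReal_lt_ofReal_iff hε'0).1 he).le

/-! ### The Bellman function -/

/-- The lower bound for the Bellman function in the subcritical range. -/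
lemma le_bellman_of_subcritical (hn : 1 ≤ n) {ε δ : ℝ} (hε : 0 < ε)
    (hs : Subcritical ((2 : ℝ) ^ n)⁻¹ ε) (hδ : IsDelta ((2 : ℝ) ^ n)⁻¹ ε δ)
    {Q : Set (Fin n → ℝ)} (hQ : Q ∈ dyadicCubes n) {x : ℝ × ℝ} (hx : x ∈ strip ε) :
    ENNReal.ofReal (Bfun δ x) ≤ bellman n Q ε x := by
  have hα0 : 0 < ((2 : ℝ) ^ n)⁻¹ := by positivity
  have hδ1 : δ < 1 := hδ.2.2.trans_le (min_le_left _ _)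
  have hp := profile_pos hδ1
  have hdata := hδ.candidateData hα0 hε hs
  have hK := (g_eq_zero_iff hδ1).1 hδ.1
  have hρ0 := hdata.ρ_pos
  have hδ0 := hdata.δ_pos
  have hsq := hdata.sq_eq
  rw [mem_strip_iff] at hx
  have hK' : K ((2 : ℝ) ^ n)⁻¹ ε = (profile δ)⁻¹ * profile √(δ ^ 2 - ε ^ 2) := by
    rw [hK]; field_simp
  have htop := tendsto_topValue hs
  rw [hK'] at htop
  have hx2 : x = (x.1, x.1 ^ 2 + var x) := by apply Prod.ext <;> simp [var]
  rcases hx.1.eq_or_lt with h0 | h0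
  · rw [Bfun_eq, ← h0, sub_zero, Real.sqrt_sq hδ0.le]
    have e : (profile δ)⁻¹ * (Real.exp x.1 * profile δ) = Real.exp x.1 := by field_simp
    rw [e]
    have := (attained_const hε.le hQ x.1).le_bellman
    rw [← h0, add_zero] at hx2
    rwa [← hx2] at this
  rcases hx.2.eq_or_lt with h1 | h1
  · rw [Bfun_eq, h1]
    rw [h1] at hx2
    have e : Real.exp x.1 * ((profile δ)⁻¹ * profile √(δ ^ 2 - ε ^ 2)) =
        (profile δ)⁻¹ * (Real.exp x.1 * profile √(δ ^ 2 - ε ^ 2)) := by ring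
    have hlim := (ENNReal.continuous_ofReal.tendsto _).comp (htop.const_mul (Real.exp x.1))
    rw [e] at hlim
    exact le_of_tendsto' hlim fun m =>
      (hx2 ▸ attained_top hn hε.le m x.1 Q hQ : Attained ε Q x _).le_bellman
  · -- The point divides an extremal tangent segment of the candidate in the ratio `t`.
    set ρ := √(δ ^ 2 - ε ^ 2) with hρ
    set r := √(δ ^ 2 - var x) with hr
    have hr2 : r ^ 2 = δ ^ 2 - var x := Real.sq_sqrt (by nlinarith)
    have hr0 : 0 ≤ r := Real.sqrt_nonneg _
    have hρr : ρ < r := lt_of_pow_lt_pow_left₀ 2 hr0 (by linarith)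
    have hrδ : r < δ := lt_of_pow_lt_pow_left₀ 2 hδ0.le (by linarith)
    have hne : δ - ρ ≠ 0 := by linarith
    set t := (δ - r) / (δ - ρ) with ht
    have hth : t * (δ - ρ) = δ - r := by rw [ht]; field_simp
    have ht0 : 0 < t := div_pos (by linarith) (by linarith)
    have ht1 : t < 1 := by rw [ht, div_lt_one (by linarith)]; linarith
    have hhε : δ - ρ < ε := by nlinarith
    obtain ⟨s, H, hst, hHt, hev⟩ := exists_attained_interior hn hε hQ ht0 ht1
      (by linarith : 0 ≤ δ - ρ) hhε (x := x) (by
        clear_value t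
        have e1 : var x = δ ^ 2 - r ^ 2 := by linarith
        have e2 : ε ^ 2 = δ ^ 2 - ρ ^ 2 := by linarith
        rw [e1, e2]
        linear_combination -(2 * δ - t * (δ - ρ) - (δ - r)) * hth)
    have hlim : Filter.Tendsto (fun p => ENNReal.ofReal
        (s p * (Real.exp (x.1 + (1 - s p) * H p) * topValue n ε p) +
          (1 - s p) * Real.exp (x.1 - s p * H p))) Filter.atTop (nhds (ENNReal.ofReal
        (t * (Real.exp (x.1 + (1 - t) * (δ - ρ)) * ((profile δ)⁻¹ * profile ρ)) +
          (1 - t) * Real.exp (x.1 - t * (δ - ρ))))) := by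
      refine (ENNReal.continuous_ofReal.tendsto _).comp ?_
      have h1s := hst.const_sub 1
      refine (hst.mul (Filter.Tendsto.mul ?_ htop)).add (h1s.mul ?_)
      · exact (Real.continuous_exp.tendsto _).comp ((h1s.mul hHt).const_add _)
      · exact (Real.continuous_exp.tendsto _).comp ((hst.mul hHt).const_sub _)
    have e : t * (Real.exp (x.1 + (1 - t) * (δ - ρ)) * ((profile δ)⁻¹ * profile ρ)) +
          (1 - t) * Real.exp (x.1 - t * (δ - ρ)) = Bfun δ x := by
      have e1 : x.1 + (1 - t) * (δ - ρ) = x.1 + r - ρ := by linear_combination -hth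
      have e2 : x.1 - t * (δ - ρ) = x.1 + r - δ := by linear_combination -hth
      have e3 : 1 - r = t * (1 - ρ) + (1 - t) * (1 - δ) := by linear_combination -hth
      rw [Bfun_eq, e1, e2, ← hr]
      have hδ' : 1 - δ ≠ 0 := by linarith
      unfold profile
      rw [e3, Real.exp_sub, Real.exp_sub, Real.exp_add]
      field_simp
    rw [e] at hlim
    exact le_of_tendsto hlim (hev.mono fun p hp => hp.2.2.2.le_bellman)

lemma bellman_eq_top_of_not_subcritical (hn : 1 ≤ n) {ε : ℝ} (hε : 0 < ε)
    (hs : ¬ Subcritical ((2 : ℝ) ^ n)⁻¹ ε) {Q : Set (Fin n → ℝ)} (hQ : Q ∈ dyadicCubes n)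
    {x : ℝ × ℝ} (h0 : 0 < var x) (h1 : var x ≤ ε ^ 2) : bellman n Q ε x = ⊤ := by
  have htop := tendsto_topValue_atTop hn hs
  have hx2 : x = (x.1, x.1 ^ 2 + var x) := by apply Prod.ext <;> simp [var]
  rw [eq_top_iff]
  rcases h1.eq_or_lt with h1 | h1
  · rw [h1] at hx2
    refine le_of_tendsto' (f := fun m => ENNReal.ofReal (Real.exp x.1 * topValue n ε m))
      (ENNReal.tendsto_ofReal_atTop.comp (htop.const_mul_atTop (Real.exp_pos x.1)))
      (fun m => (hx2 ▸ attained_top hn hε.le m x.1 Q hQ : Attained ε Q x _).le_bellman)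
  · have hε2 : 0 < ε ^ 2 := by positivity
    have ht0 : 0 < var x / ε ^ 2 := by positivity
    obtain ⟨s, H, hst, hHt, hev⟩ := exists_attained_interior hn hε hQ ht0
      ((div_lt_one hε2).2 h1) le_rfl hε (x := x) (by field_simp; ring)
    have hlim : Filter.Tendsto (fun p => ENNReal.ofReal (s p * (Real.exp x.1 * topValue n ε p)))
        Filter.atTop (nhds ⊤) :=
      ENNReal.tendsto_ofReal_atTop.comp
        (hst.pos_mul_atTop ht0 (htop.const_mul_atTop (Real.exp_pos x.1)))
    refine le_of_tendsto hlim (hev.mono fun p ⟨hp0, hp1, hH, hp⟩ => ?_)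
    refine le_trans (ENNReal.ofReal_le_ofReal ?_) hp.le_bellman
    have h2 : Real.exp x.1 ≤ Real.exp (x.1 + (1 - s p) * H p) :=
      Real.exp_le_exp.2 (le_add_of_nonneg_right (mul_nonneg (by linarith) hH))
    have h3 := mul_le_mul_of_nonneg_left
      (mul_le_mul_of_nonneg_right h2 (topValue_pos hn ε p).le) hp0.le
    have h4 : 0 ≤ (1 - s p) * Real.exp (x.1 - s p * H p) :=
      mul_nonneg (by linarith) (Real.exp_pos _).le
    linarith

/-- On the lower boundary only the constant functions compete. -/
lemma bellman_eq_of_var_eq_zero {ε : ℝ} (hε : 0 ≤ ε) {Q : Set (Fin n → ℝ)}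
    (hQ : Q ∈ dyadicCubes n) {x : ℝ × ℝ} (h0 : var x = 0) :
    bellman n Q ε x = ENNReal.ofReal (Real.exp x.1) := by
  apply le_antisymm
  · refine sSup_le ?_
    rintro y ⟨φ, hφ, h1, h2, rfl⟩
    rw [mem_bmoBallOn_iff hQ hε] at hφ
    obtain ⟨hi, hsq⟩ := average_sub_sq hQ hφ.1 hφ.2.1 x.1
    rw [h1, h2] at hsq
    have hz : ⨍ t in Q, (φ t - x.1) ^ 2 = 0 := by
      rw [hsq]; simp only [var] at h0; linarith
    rw [← expAverage_const hQ, expAverage, expAverage, setLAverage_eq, setLAverage_eq]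
    obtain ⟨l, k, rfl⟩ := hQ
    have hr : volume.real (cube n l k) ≠ 0 :=
      (ENNReal.toReal_pos (volume_cube_ne_zero l k) (volume_cube_ne_top l k)).ne'
    rw [setAverage_eq, smul_eq_zero_iff_right (inv_ne_zero hr),
      integral_eq_zero_iff_of_nonneg (fun t => sq_nonneg _) hi] at hz
    refine le_of_eq ?_
    congr 1
    apply lintegral_congr_ae
    filter_upwards [hz] with t ht
    have : φ t = x.1 := by
      have := pow_eq_zero_iff (two_ne_zero) |>.1 (show (φ t - x.1) ^ 2 = 0 from ht)
      linarith
    rw [this]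
  · have hx2 : x = (x.1, x.1 ^ 2) := by
      apply Prod.ext
      · rfl
      · simp only [var] at h0; linarith
    exact (hx2 ▸ attained_const hε hQ x.1 : Attained ε Q x _).le_bellman

end Sharp

end DyadicBMO

end

theorem theorem3p5 (n : ℕ) (hn : 1 ≤ n) (Q : Set (Fin n → ℝ)) (hQ : Q ∈ DyadicBMO.dyadicCubes n)
    (ε : ℝ) (hε : 0 < ε) :
    (ENNReal.ofReal ε < DyadicBMO.sharpEps n →
      (∃! δ : ℝ, DyadicBMO.IsDelta ((2 : ℝ) ^ n)⁻¹ ε δ) ∧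
      ∀ x ∈ DyadicBMO.strip ε,
        DyadicBMO.bellman n Q ε x = ENNReal.ofReal (DyadicBMO.Bcand ((2 : ℝ) ^ n)⁻¹ ε x)) ∧
    (DyadicBMO.sharpEps n ≤ ENNReal.ofReal ε →
      (∀ x ∈ DyadicBMO.parabola 0,
        DyadicBMO.bellman n Q ε x = ENNReal.ofReal (Real.exp x.1)) ∧
      ∀ x ∈ DyadicBMO.strip ε \ DyadicBMO.parabola 0,
        DyadicBMO.bellman n Q ε x = ⊤) := by
  have hα0 : 0 < ((2 : ℝ) ^ n)⁻¹ := by positivity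
  constructor
  · intro h
    have hs := (DyadicBMO.lt_sharpEps_iff hn hε).1 h
    have hu := DyadicBMO.existsUnique_isDelta hα0 (DyadicBMO.inv_two_pow_lt_one hn) hε hs
    refine ⟨hu, fun x hx => ?_⟩
    have hδ : DyadicBMO.IsDelta ((2 : ℝ) ^ n)⁻¹ ε (DyadicBMO.delta ((2 : ℝ) ^ n)⁻¹ ε) :=
      Classical.epsilon_spec hu.exists
    have hδ1 := hδ.2.2.trans_le (min_le_left _ _)
    apply le_antisymm
    · refine sSup_le ?_
      rintro y ⟨φ, hφ, h1, h2, rfl⟩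
      have hm : DyadicBMO.moments Q φ = x := Prod.ext h1 h2
      have := (hδ.candidateData hα0 hε hs).expAverage_le hδ1 hQ hφ
      rwa [hm] at this
    · exact DyadicBMO.le_bellman_of_subcritical hn hε hs hδ hQ hx
  · intro h
    have hs : ¬ DyadicBMO.Subcritical ((2 : ℝ) ^ n)⁻¹ ε := fun hs =>
      absurd ((DyadicBMO.lt_sharpEps_iff hn hε).2 hs) (not_lt.2 h)
    refine ⟨fun x hx => ?_, fun x hx => ?_⟩
    · apply DyadicBMO.bellman_eq_of_var_eq_zero hε.le hQ
      have : x.2 = x.1 ^ 2 + 0 ^ 2 := hx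
      simp only [DyadicBMO.var, this]; ring
    · obtain ⟨hx1, hx2⟩ := hx
      have hv := DyadicBMO.mem_strip_iff.1 hx1
      apply DyadicBMO.bellman_eq_top_of_not_subcritical hn hε hs hQ _ hv.2
      refine lt_of_le_of_ne hv.1 fun h0 => hx2 ?_
      change x.2 = x.1 ^ 2 + 0 ^ 2
      simp only [DyadicBMO.var] at h0
      linarith
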